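/- **Setting.** Let $\mathcal X$ be a Hilbert space over $\mathbb K\in\{\mathbb R,\mathbb C\}$ with norm $|||\cdot|||$ and scalar product $(\cdot,\cdot)$, $F\in\mathcal X'$, and let $\mathcal A:\mathcal X\to\mathcal X'$ satisfy $\alpha|||w-v|||^2\le\mathrm{Re}\langle\mathcal Aw-\mathcal Av,w-v\rangle$ and $|||\mathcal Aw-\mathcal Av|||'\le L|||w-v|||$ with $0<\alpha\le L$, and have a potential: $\mathrm{Re}\langle\mathcal Aw,v\rangle=\lim_{t\to0,\,t\in\mathbb R}\mathrm{Re}(P(w+tv)-P(w))/t$ for some $P:\mathcal X\to\mathbb K$. Let $u^\star$ solve $\langle\mathcal Au^\star,v\rangle=F(v)$ for all $v\in\mathcal X$. Meshes are finite sets of elements, $\mathcal T_0\ne\emptyset$ is the initial mesh, and for $\mathcal M\subseteq\mathcal T$ the mesh $\mathtt{refine}(\mathcal T,\mathcal M)$ satisfies $\mathcal M\subseteq\mathcal T\setminus\mathtt{refine}(\mathcal T,\mathcal M)$; $\mathtt{refine}(\mathcal T)$ is the set of meshes obtained from $\mathcal T$ by finitely many such steps, and $\mathbb T=\mathtt{refine}(\mathcal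 T_0)$. For $\mathcal T_H\in\mathbb T$ let $\mathcal X_H\subseteq\mathcal X$ be finite-dimensional, with $\mathcal X_H\subseteq\mathcal X_h$ if $\mathcal T_h\in\mathtt{refine}(\mathcal T_H)$, and let $u_H^\star\in\mathcal X_H$ solve $\langle\mathcal Au_H^\star,v_H\rangle=F(v_H)$ for all $v_H\in\mathcal X_H$. With constants $C_{\rm son}\ge2$, $C_{\rm mesh}>0$ suppose: (R1) $\#(\mathcal T_H\setminus\mathcal T_h)+\#\mathcal T_H\le\#\mathcal T_h\le C_{\rm son}\#(\mathcal T_H\setminus\mathcal T_h)+\#(\mathcal T_H\cap\mathcal T_h)$ for $\mathcal T_H\in\mathbb T$ and $\mathcal T_h=\mathtt{refine}(\mathcal T_H,\mathcal M_H)$; (R2) for $\mathcal T\in\mathbb T$ and $\mathcal T_H,\mathcal T_h\in\mathtt{refine}(\mathcal T)$ there is $\mathcal T_H\oplus\mathcal T_h\in\mathtt{refine}(\mathcal T_H)\cap\mathtt{refine}(\mathcal T_h)$ with $\#(\mathcal T_H\oplus\mathcal T_h)\le\#\mathcal T_H+\#\mathcal T_h-\#\mathcal T$; (R3) $\#\mathcal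 T_\ell-\#\mathcal T_0\le C_{\rm mesh}\sum_{i<\ell}\#\mathcal M_i$ whenever $\mathcal T_{i+1}=\mathtt{refine}(\mathcal T_i,\mathcal M_i)$ with $\mathcal M_i\subseteq\mathcal T_i$ for all $i\in\mathbb N_0$. Let $\eta_H(T,v_H)\ge0$ for $T\in\mathcal T_H$ and $v_H\in\mathcal X_H$, $\eta_H(\mathcal V,v)=(\sum_{T\in\mathcal V}\eta_H(T,v)^2)^{1/2}$, $\eta_H(v)=\eta_H(\mathcal T_H,v)$. With $C_{\rm stab},C_{\rm rel}>0$ and $0<q_{\rm red}<1$ suppose for all $\mathcal T_H\in\mathbb T$, $\mathcal T_h\in\mathtt{refine}(\mathcal T_H)$, $v_H\in\mathcal X_H$, $v_h\in\mathcal X_h$: (A1) $|\eta_h(\mathcal V,v_h)-\eta_H(\mathcal V,v_H)|\le C_{\rm stab}|||v_h-v_H|||$ for $\mathcal V\subseteq\mathcal T_H\cap\mathcal T_h$; (A2) $\eta_h(\mathcal T_h\setminus\mathcal T_H,v_H)\le q_{\rm red}\,\eta_H(\mathcal T_H\setminus\mathcal T_h,v_H)$; (A3) $|||u^\star-u_H^\star|||\le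 C_{\rm rel}\,\eta_H(u_H^\star)$; (A4) $|||u_h^\star-u_H^\star|||\le C_{\rm rel}\,\eta_H(\mathcal T_H\setminus\mathcal T_h,u_H^\star)$. Suppose an algebraic solver is given which, for each $\mathcal T_H\in\mathbb T$, $G\in\mathcal X'$ and initial guess $u_H^0\in\mathcal X_H$, yields $u_H^j\in\mathcal X_H$ with $|||u_H^\flat-u_H^{j}|||\le q_{\rm alg}|||u_H^\flat-u_H^{j-1}|||$ for $j\ge1$, where $0<q_{\rm alg}<1$ and $u_H^\flat\in\mathcal X_H$ solves $(u_H^\flat,v_H)=G(v_H)$ for all $v_H\in\mathcal X_H$. **Algorithm.** Input: $u_0^{0,0}\in\mathcal X_0$, $0<\theta\le1$, $0<\lambda_{\rm alg}<1$, $\lambda_{\rm Pic}>0$, $C_{\rm mark}\ge1$. For $\ell=0,1,\dots$ and, for fixed $\ell$, $k=1,2,\dots$: set $u_\ell^{k,0}$ to the previously computed iterate ($u_\ell^{0,0}$ if $k=1$); let $u_\ell^{k,\star}\in\mathcal X_\ell$ solve $(u_\ell^{k,\star},v)=(u_\ell^{k,0},v)-\frac{\alpha}{L^2}\langle\mathcal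 Au_\ell^{k,0}-F,v\rangle$ for all $v\in\mathcal X_\ell$; compute solver iterates $u_\ell^{k,j}$, $j=1,2,\dots$, for this system from $u_\ell^{k,0}$ until $|||u_\ell^{k,j}-u_\ell^{k,j-1}|||\le\lambda_{\rm alg}[\eta_\ell(u_\ell^{k,j})+|||u_\ell^{k,j}-u_\ell^{k,0}|||]$; stop the $k$-loop if, for the final $j$, $|||u_\ell^{k,j}-u_\ell^{k,0}|||\le\lambda_{\rm Pic}\,\eta_\ell(u_\ell^{k,j})$. With $u=u_\ell^{k,j}$ the last iterate: exit if $\eta_\ell(u)=0$; otherwise choose $\mathcal M_\ell\subseteq\mathcal T_\ell$ with $\theta\,\eta_\ell(u)\le\eta_\ell(\mathcal M_\ell,u)$ of minimal cardinality up to the factor $C_{\rm mark}$, and set $\mathcal T_{\ell+1}=\mathtt{refine}(\mathcal T_\ell,\mathcal M_\ell)$, $u_{\ell+1}^{0,0}=u$. Let $\mathcal Q$ be the set of all triples $(\ell,k,j)$ used (including those with $j=0$ and $k=0$), $\underline\ell=\sup\{\ell:(\ell,0,0)\in\mathcal Q\}\in\mathbb N_0\cup\{\infty\}$, and, with $u_\ell^{0,\star}:=u_\ell^{0,0}$,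 $$\Delta_\ell^{k,j}=|||u^\star-u_\ell^{k,j}|||+|||u_\ell^{k,\star}-u_\ell^{k,j}|||+\eta_\ell(u_\ell^{k,j}).$$ **Constants.** Let $q_{\rm Pic}=(1-\alpha^2/L^2)^{1/2}$, $C_{\rm Pic}=q_{\rm Pic}/(1-q_{\rm Pic})$, $C_{\rm alg}=q_{\rm alg}/(1-q_{\rm alg})$, $\theta_{\rm opt}=(1+C_{\rm stab}^2C_{\rm rel}^2)^{-1}$. Let $\lambda_{\rm alg}^\star>0$ be such that $0<q_{\rm Pic}':=\frac{q_{\rm Pic}+C_{\rm alg}\lambda_{\rm alg}^\star}{1-C_{\rm alg}\lambda_{\rm alg}^\star}<1$, and $\lambda_{\rm Pic}^\star=\frac{1-q_{\rm Pic}'}{q_{\rm Pic}'C_{\rm stab}}$. Suppose $\lambda_{\rm alg}+\lambda_{\rm alg}/\lambda_{\rm Pic}<\lambda_{\rm alg}^\star$ and $\lambda_{\rm Pic}/\theta<\lambda_{\rm Pic}^\star$, and put $$\theta'=\frac{\theta+C_{\rm stab}\big((1+C_{\rm Pic})C_{\rm alg}\lambda_{\rm alg}+[C_{\rm Pic}+(1+C_{\rm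 Pic})C_{\rm alg}\lambda_{\rm alg}]\lambda_{\rm Pic}\big)}{1-\lambda_{\rm Pic}/\lambda_{\rm Pic}^\star}.$$ **Theorem.** (i) There is $\theta^\star>0$, depending only on $C_{\rm stab},C_{\rm rel},q_{\rm Pic},q_{\rm alg},\lambda_{\rm alg}^\star$, such that $0<\theta'<\theta_{\rm opt}$ whenever $0<\theta<\min\{1,\theta^\star\}$. (ii) Let $s>0$ and $$\|u^\star\|_{\mathbb A_s}=\sup_{N\in\mathbb N_0}(N+1)^s\inf_{\mathcal T_{\rm opt}\in\mathbb T,\ \#\mathcal T_{\rm opt}-\#\mathcal T_0\le N}\big[|||u^\star-u_{\rm opt}^\star|||+\eta_{\rm opt}(u_{\rm opt}^\star)\big]\in[0,\infty].$$ If $\theta'<\theta_{\rm opt}$, there are $c_{\rm opt},C_{\rm opt}>0$ with $$c_{\rm opt}^{-1}\|u^\star\|_{\mathbb A_s}\le\sup_{(\ell,k,j)\in\mathcal Q}(\#\mathcal T_\ell-\#\mathcal T_0+1)^s\Delta_\ell^{k,j}\le C_{\rm opt}\max\{\|u^\star\|_{\mathbb A_s},\Delta_0^{0,0}\},$$ $$\sup_{(\ell,k,j)\in\mathcal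 Q,\ \ell\ge1}(\#\mathcal T_\ell-\#\mathcal T_0+1)^s\Delta_\ell^{k,j}\le C_{\rm opt}\|u^\star\|_{\mathbb A_s}.$$ Here $c_{\rm opt}$ depends only on $L/\alpha,C_{\rm stab},C_{\rm rel},C_{\rm son},\#\mathcal T_0,s$ and on $\underline\ell$ (where all runs with $\underline\ell=\infty$ share one constant), and $C_{\rm opt}$ depends only on $\alpha,L,C_{\rm stab},C_{\rm rel},q_{\rm red},C_{\rm mark},C_{\rm mesh},\#\mathcal T_0,q_{\rm alg},\lambda_{\rm alg}^\star,\theta,\lambda_{\rm alg},\lambda_{\rm Pic},s$. In particular, the algorithm attains every algebraic rate $s$ that is attainable over $\mathbb T$. -/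

import Mathlib

open Filter Topology
open scoped ENNReal

universe u v w

namespace AFEM

/-- `variationalSol B G U` is the solution `x ∈ U` of `B x v = G v` for all `v ∈ U`. It exists and is
unique for strongly monotone Lipschitz continuous `B` and complete `U`, see `variationalSol_spec`
and `variationalSol_unique`. -/
noncomputable def variationalSol {𝕜 V : Type*} [RCLike 𝕜] [NormedAddCommGroup V]
    [InnerProductSpace 𝕜 V] (B : V → V →L[𝕜] 𝕜) (G : V →L[𝕜] 𝕜) (U : Submodule 𝕜 V) : V :=
  Classical.epsilon fun x => x ∈ U ∧ ∀ v ∈ U, B x v = G v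

/-- Strong monotonicity (constant `α`) and Lipschitz continuity (constant `L`, operator norm in
the dual space). -/
structure IsMonotoneLipschitz {𝕜 V : Type*} [RCLike 𝕜] [NormedAddCommGroup V]
    [InnerProductSpace 𝕜 V] (B : V → V →L[𝕜] 𝕜) (α L : ℝ) : Prop where
  alpha_pos : 0 < α
  alpha_le : α ≤ L
  monotone : ∀ w v : V, α * ‖w - v‖ ^ 2 ≤ RCLike.re ((B w - B v) (w - v))
  lipschitz : ∀ w v : V, ‖B w - B v‖ ≤ L * ‖w - v‖

theorem isMonotoneLipschitz_innerSL {𝕜 V : Type*} [RCLike 𝕜] [NormedAddCommGroup V]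
    [InnerProductSpace 𝕜 V] :
    IsMonotoneLipschitz (𝕜 := 𝕜) (fun x : V => innerSL 𝕜 x) 1 1 where
  alpha_pos := one_pos
  alpha_le := le_rfl
  monotone w v := by
    rw [← map_sub, innerSL_apply_apply, inner_self_eq_norm_sq, one_mul]
  lipschitz w v := by
    rw [← map_sub, innerSL_apply_norm, one_mul]

theorem variationalSol_unique {𝕜 V : Type*} [RCLike 𝕜] [NormedAddCommGroup V]
    [InnerProductSpace 𝕜 V] {B : V → V →L[𝕜] 𝕜} {α L : ℝ} (hB : IsMonotoneLipschitz B α L)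
    (G : V →L[𝕜] 𝕜) (U : Submodule 𝕜 V) {x y : V}
    (hx : x ∈ U ∧ ∀ v ∈ U, B x v = G v) (hy : y ∈ U ∧ ∀ v ∈ U, B y v = G v) : x = y := by
  have hm := hB.monotone x y
  have hmem := U.sub_mem hx.1 hy.1
  have h0 : (B x - B y) (x - y) = 0 := by
    rw [sub_apply, hx.2 _ hmem, hy.2 _ hmem, sub_self]
  rw [h0, map_zero] at hm
  have h1 : ‖x - y‖ ^ 2 ≤ 0 := by
    by_contra! h
    have := mul_pos hB.alpha_pos h
    linarith
  have h2 : ‖x - y‖ = 0 := by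
    have := sq_nonneg ‖x - y‖
    exact pow_eq_zero_iff (two_ne_zero) |>.1 (le_antisymm h1 this)
  exact sub_eq_zero.1 (norm_eq_zero.1 h2)

theorem variationalSol_spec {𝕜 V : Type*} [RCLike 𝕜] [NormedAddCommGroup V]
    [InnerProductSpace 𝕜 V] [CompleteSpace V] {B : V → V →L[𝕜] 𝕜} {α L : ℝ}
    (hB : IsMonotoneLipschitz B α L) (G : V →L[𝕜] 𝕜) (U : Submodule 𝕜 V) [CompleteSpace U] :
    variationalSol B G U ∈ U ∧ ∀ v ∈ U, B (variationalSol B G U) v = G v := by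
  have hL : 0 < L := hB.alpha_pos.trans_le hB.alpha_le
  have hα := hB.alpha_pos
  set δ : ℝ := α / L ^ 2 with hδ
  have hδ0 : 0 < δ := by positivity
  let r : U → U := fun w => (InnerProductSpace.toDual 𝕜 U).symm ((B w - G).comp U.subtypeL)
  have hr : ∀ w v : U, inner 𝕜 (r w) v = (B w - G) (v : V) := fun w v => by
    simp only [r, InnerProductSpace.toDual_symm_apply, ContinuousLinearMap.comp_apply,
      Submodule.subtypeL_apply]
  have hrr : ∀ w v z : U, inner 𝕜 (r w - r v) z = (B w - B v) (z : V) := fun w v z => by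
    rw [inner_sub_left, hr, hr]
    simp only [sub_apply]
    ring
  let f : U → U := fun w => w - (δ : 𝕜) • r w
  have hq : 0 ≤ 1 - α ^ 2 / L ^ 2 := by
    rw [sub_nonneg, div_le_one (by positivity)]
    exact pow_le_pow_left₀ hα.le hB.alpha_le 2
  have hrn : ∀ w v : U, ‖r w - r v‖ ≤ L * ‖w - v‖ := fun w v => by
    by_contra! h
    have hpos : 0 < ‖r w - r v‖ := lt_of_le_of_lt (by positivity) h
    have h1 : ‖r w - r v‖ ^ 2 = RCLike.re ((B w - B v) ((r w - r v : U) : V)) := by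
      rw [← hrr, inner_self_eq_norm_sq]
    have h2 : RCLike.re ((B w - B v) ((r w - r v : U) : V)) ≤ ‖B w - B v‖ * ‖r w - r v‖ :=
      (RCLike.re_le_norm _).trans ((B w - B v).le_opNorm _)
    have h3 : ‖B w - B v‖ ≤ L * ‖w - v‖ := hB.lipschitz w v
    nlinarith
  have hf : ∀ w v : U, ‖f w - f v‖ ^ 2 ≤ (1 - α ^ 2 / L ^ 2) * ‖w - v‖ ^ 2 := fun w v => by
    have e : f w - f v = (w - v) - (δ : 𝕜) • (r w - r v) := by
      simp only [f, smul_sub]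
      abel
    have h1 := hrn w v
    have h2 : α * ‖w - v‖ ^ 2 ≤ RCLike.re (inner 𝕜 (r w - r v) (w - v)) := by
      rw [hrr]
      exact hB.monotone w v
    have h3 : ‖r w - r v‖ ^ 2 ≤ L ^ 2 * ‖w - v‖ ^ 2 := by
      rw [← mul_pow]
      exact pow_le_pow_left₀ (norm_nonneg _) h1 2
    rw [e, norm_sub_sq (𝕜 := 𝕜), inner_smul_right, RCLike.re_ofReal_mul, norm_smul,
      RCLike.norm_ofReal, abs_of_pos hδ0, mul_pow, ← inner_conj_symm, RCLike.conj_re]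
    have h4 := mul_le_mul_of_nonneg_left h2 hδ0.le
    have h5 := mul_le_mul_of_nonneg_left h3 (sq_nonneg δ)
    have h6 : δ ^ 2 * (L ^ 2 * ‖w - v‖ ^ 2) = α ^ 2 / L ^ 2 * ‖w - v‖ ^ 2 := by
      rw [hδ]
      field_simp
    have h7 : δ * (α * ‖w - v‖ ^ 2) = α ^ 2 / L ^ 2 * ‖w - v‖ ^ 2 := by
      rw [hδ]
      field_simp
    linarith
  have hc : ContractingWith (Real.toNNReal (Real.sqrt (1 - α ^ 2 / L ^ 2))) f := by
    refine ⟨?_, LipschitzWith.of_dist_le_mul fun w v => ?_⟩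
    · rw [Real.toNNReal_lt_one, Real.sqrt_lt' one_pos, one_pow]
      have : 0 < α ^ 2 / L ^ 2 := by positivity
      linarith
    · rw [Real.coe_toNNReal _ (Real.sqrt_nonneg _), dist_eq_norm, dist_eq_norm]
      refine abs_le_of_sq_le_sq' ?_ (by positivity) |>.2
      rw [mul_pow, Real.sq_sqrt hq]
      exact hf w v
  have hex : ∃ x, x ∈ U ∧ ∀ v ∈ U, B x v = G v := by
    refine ⟨(ContractingWith.fixedPoint f hc : U), SetLike.coe_mem _, fun v hv => ?_⟩
    have hfix : f (ContractingWith.fixedPoint f hc) = _ := hc.fixedPoint_isFixedPt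
    have h0 : r (ContractingWith.fixedPoint f hc) = 0 := by
      have : (δ : 𝕜) • r (ContractingWith.fixedPoint f hc) = 0 := sub_eq_self.1 hfix
      exact (smul_eq_zero.1 this).resolve_left (by exact_mod_cast hδ0.ne')
    have h1 := hr (ContractingWith.fixedPoint f hc) ⟨v, hv⟩
    rw [h0, inner_zero_left, sub_apply] at h1
    exact (sub_eq_zero.1 h1.symm)
  exact Classical.epsilon_spec (p := fun x => x ∈ U ∧ ∀ v ∈ U, B x v = G v) hex

/-- The objects of the abstract setting. Meshes are finite sets of elements of type `E`; the space
`X T`, the indicators `η T` and the solver are attached to a mesh `T`. `solver T G x j` is the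
`j`-th iterate of the algebraic solver for the linear system on `X T` with right-hand side `G` and
initial guess `x`. The laws are stated in the predicates below. -/
structure Setting (𝕜 V E : Type*) [RCLike 𝕜] [NormedAddCommGroup V] [InnerProductSpace 𝕜 V] where
  P : V → 𝕜
  A : V → V →L[𝕜] 𝕜
  F : V →L[𝕜] 𝕜
  α : ℝ
  L : ℝ
  refine : Finset E → Finset E → Finset E
  T₀ : Finset E
  X : Finset E → Submodule 𝕜 V
  η : Finset E → E → V → ℝ
  solver : Finset E → (V →L[𝕜] 𝕜) → V → ℕ → V

/-- Meshes, iterates `u ℓ k j` and marked sets of one run of the adaptive algorithm.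
Values at indices that the run never reaches are irrelevant. -/
structure Iterates (V E : Type*) where
  mesh : ℕ → Finset E
  marked : ℕ → Finset E
  u : ℕ → ℕ → ℕ → V

namespace Setting

variable {𝕜 V E : Type*} [RCLike 𝕜] [NormedAddCommGroup V] [InnerProductSpace 𝕜 V]
  (D : Setting 𝕜 V E)

/-! ### Operator -/

/-- `A` is strongly monotone and Lipschitz continuous with potential `P`. Only the real part of
`A = dP` is demanded: for `𝕜 = ℝ` this is `A = dP`, and in general it follows from `A = dP`. -/
structure IsOperator : Prop extends IsMonotoneLipschitz D.A D.α D.L where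
  gateaux : ∀ w v : V, Tendsto
    (fun t : ℝ => (RCLike.re (D.P (w + (t : 𝕜) • v)) - RCLike.re (D.P w)) / t)
    (𝓝[≠] 0) (𝓝 (RCLike.re (D.A w v)))

/-- The exact solution `u⋆`. -/
noncomputable def uStar : V := variationalSol D.A D.F ⊤

/-- The exact discrete solution on the mesh `T`. -/
noncomputable def uStarOn (T : Finset E) : V := variationalSol D.A D.F (D.X T)

/-- The solution `x ∈ X T` of the linear system `⟪x, v⟫ = G v` for all `v ∈ X T`. -/
noncomputable def linSol (T : Finset E) (G : V →L[𝕜] 𝕜) : V :=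
  variationalSol (fun x : V => innerSL 𝕜 x) G (D.X T)

/-- Right-hand side `v ↦ ⟪w, v⟫ - (α / L²) (A w - F) v` of the Banach-Picard step at `w`. -/
noncomputable def picardRhs (w : V) : V →L[𝕜] 𝕜 :=
  innerSL 𝕜 w - ((D.α / D.L ^ 2 : ℝ) : 𝕜) • (D.A w - D.F)

/-! ### Meshes -/

/-- `T'` is obtained from `T` by finitely many one-level refinements: `T' ∈ refine(T)`. -/
def Refines (T T' : Finset E) : Prop :=
  Relation.ReflTransGen (fun S S' => ∃ M ⊆ S, S' = D.refine S M) T T'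

/-- `T` can be generated from the initial mesh. -/
def IsMesh (T : Finset E) : Prop := D.Refines D.T₀ T

/-- Refinement of marked elements, splitting property, overlay estimate, closure estimate. -/
structure IsRefinement [DecidableEq E] (Cson Cmesh : ℝ) : Prop where
  nonempty : D.T₀.Nonempty
  marked_subset : ∀ T, D.IsMesh T → ∀ M ⊆ T, M ⊆ T \ D.refine T M
  card_le_card : ∀ T, D.IsMesh T → ∀ M ⊆ T,
    (T \ D.refine T M).card + T.card ≤ (D.refine T M).card
  card_le_son : ∀ T, D.IsMesh T → ∀ M ⊆ T,
    ((D.refine T M).card : ℝ) ≤ Cson * (T \ D.refine T M).card + (T ∩ D.refine T M).card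
  overlay : ∀ T, D.IsMesh T → ∀ T₁ T₂, D.Refines T T₁ → D.Refines T T₂ →
    ∃ T₃, D.Refines T₁ T₃ ∧ D.Refines T₂ T₃ ∧ T₃.card + T.card ≤ T₁.card + T₂.card
  closure : ∀ (S M : ℕ → Finset E), S 0 = D.T₀ → (∀ i, M i ⊆ S i) →
    (∀ i, S (i + 1) = D.refine (S i) (M i)) → ∀ i,
    ((S i).card : ℝ) - D.T₀.card ≤ Cmesh * ∑ m ∈ Finset.range i, ((M m).card : ℝ)

/-- Finite-dimensional discrete spaces, nested under refinement. -/
structure IsDiscretization : Prop where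
  finite : ∀ T, D.IsMesh T → FiniteDimensional 𝕜 (D.X T)
  nested : ∀ T, D.IsMesh T → ∀ T', D.Refines T T' → D.X T ≤ D.X T'

/-! ### Error estimator -/

/-- `η T (S, v)`, the contribution of the elements in `S` to the estimator. -/
noncomputable def etaOn (T S : Finset E) (v : V) : ℝ := √(∑ K ∈ S, D.η T K v ^ 2)

/-- The full estimator `η T (v)`. -/
noncomputable def eta (T : Finset E) (v : V) : ℝ := D.etaOn T T v

/-- Stability, reduction, reliability, discrete reliability. -/
structure IsEstimator [DecidableEq E] (Cstab Crel qred : ℝ) : Prop where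
  nonneg : ∀ T, D.IsMesh T → ∀ K ∈ T, ∀ v ∈ D.X T, 0 ≤ D.η T K v
  stability : ∀ T, D.IsMesh T → ∀ T', D.Refines T T' → ∀ v' ∈ D.X T', ∀ v ∈ D.X T,
    ∀ S ⊆ T ∩ T', |D.etaOn T' S v' - D.etaOn T S v| ≤ Cstab * ‖v' - v‖
  reduction : ∀ T, D.IsMesh T → ∀ T', D.Refines T T' → ∀ v ∈ D.X T,
    D.etaOn T' (T' \ T) v ≤ qred * D.etaOn T (T \ T') v
  reliability : ∀ T, D.IsMesh T → ‖D.uStar - D.uStarOn T‖ ≤ Crel * D.eta T (D.uStarOn T)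
  discrete_reliability : ∀ T, D.IsMesh T → ∀ T', D.Refines T T' →
    ‖D.uStarOn T' - D.uStarOn T‖ ≤ Crel * D.etaOn T (T \ T') (D.uStarOn T)

/-! ### Algebraic solver -/

/-- The algebraic solver starts at the initial guess, stays in the discrete space, and contracts
the algebraic error by the factor `qalg` in each step. -/
structure IsContractiveSolver (qalg : ℝ) : Prop where
  zero : ∀ T, D.IsMesh T → ∀ G, ∀ x ∈ D.X T, D.solver T G x 0 = x
  mem : ∀ T, D.IsMesh T → ∀ G, ∀ x ∈ D.X T, ∀ j, D.solver T G x j ∈ D.X T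
  contraction : ∀ T, D.IsMesh T → ∀ G, ∀ x ∈ D.X T, ∀ j,
    ‖D.linSol T G - D.solver T G x (j + 1)‖ ≤ qalg * ‖D.linSol T G - D.solver T G x j‖

/-! ### Adaptive algorithm

For `k ≥ 1` the iterate `u ℓ k 0` is the final iterate of the previous linearization step `k - 1`
(nested iteration), so it plays the role of `u_ℓ^{k-1,j̲}`. -/

variable (lamAlg lamPic : ℝ) (I : Iterates V E)

/-- Stopping criterion of the algebraic solver, tested for `k ≥ 1` and `j ≥ 1`. -/
def AlgStop (ℓ k j : ℕ) : Prop :=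
  ‖I.u ℓ k j - I.u ℓ k (j - 1)‖ ≤
    lamAlg * (D.eta (I.mesh ℓ) (I.u ℓ k j) + ‖I.u ℓ k j - I.u ℓ k 0‖)

/-- Stopping criterion of the linearization, tested when the algebraic solver has stopped. -/
def PicStop (ℓ k j : ℕ) : Prop :=
  ‖I.u ℓ k j - I.u ℓ k 0‖ ≤ lamPic * D.eta (I.mesh ℓ) (I.u ℓ k j)

/-- The index set of the algorithm: `Used ℓ k j` says that the index triple `(ℓ, k, j)` is used. -/
inductive Used : ℕ → ℕ → ℕ → Prop
  | start : Used 0 0 0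
  | first_picard (ℓ : ℕ) : Used ℓ 0 0 → Used ℓ 1 0
  | first_alg (ℓ k : ℕ) : 1 ≤ k → Used ℓ k 0 → Used ℓ k 1
  | next_alg (ℓ k j : ℕ) : 1 ≤ k → 1 ≤ j → Used ℓ k j → ¬ D.AlgStop lamAlg I ℓ k j →
      Used ℓ k (j + 1)
  | next_picard (ℓ k j : ℕ) : 1 ≤ k → 1 ≤ j → Used ℓ k j → D.AlgStop lamAlg I ℓ k j →
      ¬ D.PicStop lamPic I ℓ k j → Used ℓ (k + 1) 0
  | next_mesh (ℓ k j : ℕ) : 1 ≤ k → 1 ≤ j → Used ℓ k j → D.AlgStop lamAlg I ℓ k j →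
      D.PicStop lamPic I ℓ k j → D.eta (I.mesh ℓ) (I.u ℓ k j) ≠ 0 → Used (ℓ + 1) 0 0

/-- `M ⊆ T` satisfies the Dörfler criterion for `v` and has minimal cardinality up to `Cmark`. -/
def IsMarking (θ Cmark : ℝ) (T M : Finset E) (v : V) : Prop :=
  M ⊆ T ∧ θ * D.eta T v ≤ D.etaOn T M v ∧
    ∀ M' ⊆ T, θ * D.eta T v ≤ D.etaOn T M' v → (M.card : ℝ) ≤ Cmark * M'.card

/-- `I` is a run of the adaptive algorithm. -/
structure IsRun (θ Cmark : ℝ) : Prop where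
  mesh_zero : I.mesh 0 = D.T₀
  initial : I.u 0 0 0 ∈ D.X D.T₀
  first_picard : ∀ ℓ, D.Used lamAlg lamPic I ℓ 0 0 → I.u ℓ 1 0 = I.u ℓ 0 0
  alg_step : ∀ ℓ k j, 1 ≤ k → D.Used lamAlg lamPic I ℓ k j →
    I.u ℓ k j = D.solver (I.mesh ℓ) (D.picardRhs (I.u ℓ k 0)) (I.u ℓ k 0) j
  next_picard : ∀ ℓ k j, 1 ≤ k → 1 ≤ j → D.Used lamAlg lamPic I ℓ k j →
    D.AlgStop lamAlg I ℓ k j → ¬ D.PicStop lamPic I ℓ k j → I.u ℓ (k + 1) 0 = I.u ℓ k j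
  next_mesh : ∀ ℓ k j, 1 ≤ k → 1 ≤ j → D.Used lamAlg lamPic I ℓ k j →
    D.AlgStop lamAlg I ℓ k j → D.PicStop lamPic I ℓ k j →
    D.eta (I.mesh ℓ) (I.u ℓ k j) ≠ 0 →
    D.IsMarking θ Cmark (I.mesh ℓ) (I.marked ℓ) (I.u ℓ k j) ∧
      I.mesh (ℓ + 1) = D.refine (I.mesh ℓ) (I.marked ℓ) ∧ I.u (ℓ + 1) 0 0 = I.u ℓ k j

/-- The last mesh index `ℓ̲ ∈ ℕ ∪ {∞}`. -/
noncomputable def lastMesh : ℕ∞ :=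
  ⨆ (ℓ : ℕ) (_ : D.Used lamAlg lamPic I ℓ 0 0), (ℓ : ℕ∞)

/-! ### Quasi-error and approximation class -/

/-- The exact solution `u_ℓ^{k,⋆}` of the linearized problem, with `u_ℓ^{0,⋆} = u_ℓ^{0,0}`. -/
noncomputable def uPicard (ℓ k : ℕ) : V :=
  if k = 0 then I.u ℓ 0 0 else D.linSol (I.mesh ℓ) (D.picardRhs (I.u ℓ k 0))

/-- The quasi-error: overall error, algebraic error and error estimator. -/
noncomputable def quasiError (ℓ k j : ℕ) : ℝ :=
  ‖D.uStar - I.u ℓ k j‖ + ‖D.uPicard I ℓ k - I.u ℓ k j‖ + D.eta (I.mesh ℓ) (I.u ℓ k j)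

/-- The quasi-error weighted with the rate `s`, as an extended nonnegative number. -/
noncomputable def weightedError (s : ℝ) (ℓ k j : ℕ) : ℝ≥0∞ :=
  ENNReal.ofReal ((((I.mesh ℓ).card : ℝ) - D.T₀.card + 1) ^ s * D.quasiError I ℓ k j)

/-- The approximation norm `‖u⋆‖_{A_s} ∈ [0, ∞]`. -/
noncomputable def approxNorm (s : ℝ) : ℝ≥0∞ :=
  ⨆ N : ℕ, ENNReal.ofReal (((N : ℝ) + 1) ^ s) *
    ⨅ (T : Finset E) (_ : D.IsMesh T ∧ (T.card : ℝ) - D.T₀.card ≤ N),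
      ENNReal.ofReal (‖D.uStar - D.uStarOn T‖ + D.eta T (D.uStarOn T))

end Setting

/-! ### Constants -/

/-- The contraction factor of the exact Banach-Picard iteration. -/
noncomputable def qPic (α L : ℝ) : ℝ := √(1 - α ^ 2 / L ^ 2)

/-- The contraction factor of the perturbed Banach-Picard iteration for the threshold
`lamAlgStar`. -/
noncomputable def qPicPert (qpic qalg lamAlgStar : ℝ) : ℝ :=
  (qpic + qalg / (1 - qalg) * lamAlgStar) / (1 - qalg / (1 - qalg) * lamAlgStar)

/-- The threshold for `λ_Pic / θ`. -/
noncomputable def lamPicStar (Cstab qpic qalg lamAlgStar : ℝ) : ℝ :=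
  (1 - qPicPert qpic qalg lamAlgStar) / (qPicPert qpic qalg lamAlgStar * Cstab)

/-- `θ_opt`. -/
noncomputable def thetaOpt (Cstab Crel : ℝ) : ℝ := (1 + Cstab ^ 2 * Crel ^ 2)⁻¹

/-- `θ'`, the perturbed marking parameter. -/
noncomputable def thetaPrime (Cstab qpic qalg lamAlgStar θ lamAlg lamPic : ℝ) : ℝ :=
  let Cpic := qpic / (1 - qpic)
  let Calg := qalg / (1 - qalg)
  (θ + Cstab * ((1 + Cpic) * Calg * lamAlg + (Cpic + (1 + Cpic) * Calg * lamAlg) * lamPic)) /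
    (1 - lamPic / lamPicStar Cstab qpic qalg lamAlgStar)

/-- Admissible generic constants, with a threshold `lamAlgStar` for which the perturbed
Banach-Picard iteration has a contraction factor in `(0, 1)`. -/
structure AdmissibleConstants (α L Cstab Crel qred Cson Cmesh qalg lamAlgStar : ℝ) : Prop where
  alpha_pos : 0 < α
  alpha_le : α ≤ L
  stab_pos : 0 < Cstab
  rel_pos : 0 < Crel
  red_pos : 0 < qred
  red_lt : qred < 1
  son_ge : 2 ≤ Cson
  mesh_pos : 0 < Cmesh
  alg_pos : 0 < qalg
  alg_lt : qalg < 1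
  star_pos : 0 < lamAlgStar
  pert_pos : 0 < qPicPert (qPic α L) qalg lamAlgStar
  pert_lt : qPicPert (qPic α L) qalg lamAlgStar < 1

/-- The smallness conditions on the adaptivity parameters under which the algorithm converges
linearly. -/
structure AdmissibleParameters (lamAlgStar lamPicSt θ lamAlg lamPic : ℝ) : Prop where
  theta_pos : 0 < θ
  theta_le : θ ≤ 1
  alg_pos : 0 < lamAlg
  alg_lt : lamAlg < 1
  pic_pos : 0 < lamPic
  alg_small : lamAlg + lamAlg / lamPic < lamAlgStar
  pic_small : lamPic / θ < lamPicSt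

end AFEM

/-!
The proof never tracks quasi-errors along the full index set. It reduces everything to the exact
discrete solutions `u_ℓ⋆` on the meshes of the run, for which the classical theory of optimal
adaptivity applies.

*Final iterates.* On a level `ℓ` the Banach-Picard map contracts by `qPic` (`norm_sub_picard_le`).
With the two stopping criteria this gives `‖u_ℓ⋆ - u‖ ≤ K η_ℓ(u)` for the final iterate `u`, where
`Cstab K` is exactly the perturbation in the numerator of `θ'` (`norm_sub_le_of_isFinal`), and
the smallness conditions yield `Cstab K ≤ λ_Pic / λ_Pic⋆ < θ` (`stab_mul_finalConst_le`). So
`η_ℓ(u)` and `η_ℓ(u_ℓ⋆)` are equivalent, Dörfler marking for `u` implies Dörfler marking for `u_ℓ⋆`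
with the parameter `(θ - Cstab K) / (1 + Cstab K)`, and Dörfler marking for `u_ℓ⋆` with the
parameter `θ'` implies it for `u` with the parameter `θ` (`level_step`). Part (i) of the theorem is
the resulting estimate `θ' < 2 θ / (1 - θ)`.

*Linear convergence.* The potential provides an energy whose differences to a Galerkin solution are
equivalent to squared errors (`energy_sub_bounds`). Hence the perturbation `‖u_{ℓ+1}⋆ - u_ℓ⋆‖²` in
the estimator reduction telescopes, and `η_ℓ(u_ℓ⋆)²` plus a multiple of the energy error contracts
from level to level (`lyap_contract`).

*Upper bound.* For `θ' < θ_opt`, the overlay of `T_ℓ` with a mesh that realizes the approximation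
norm yields a set with the Dörfler property whose cardinality is at most a constant times
`(‖u⋆‖_{A_s} / η_ℓ(u_ℓ⋆))^{1/s}` (`exists_doerfler_card_le`). Quasi-minimal marking, the closure
estimate and a geometric series (`sum_inv_rpow_le`) bound `#T_{m+1} - #T_0` by a multiple of
`(‖u⋆‖_{A_s} / η_m(u_m⋆))^{1/s}`, while all quasi-errors on level `m + 1` are at most a multiple
of `η_m(u_m⋆)` (`quasiError_le_initial`, `level_step`).

*Lower bound.* For given `N`, the finest mesh of the run with at most `N` additional elements is a
competitor in the approximation norm. If it is not the last one, its successor has more than `N`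
additional elements but at most `Cson` times as many elements. If it is the last one, then
`u⋆ = u_ℓ⋆` and the estimator vanishes there (`eta_uStarOn_eq_zero`), so that the constant does not
depend on the last level.
-/

namespace AFEM

/-! ### Strongly monotone Lipschitz operators with potential -/

section Hilbert

variable {𝕜 V : Type*} [RCLike 𝕜] [NormedAddCommGroup V] [InnerProductSpace 𝕜 V]

theorem qPic_nonneg (α L : ℝ) : 0 ≤ qPic α L := Real.sqrt_nonneg _

theorem qPic_lt_one {α L : ℝ} (hα : 0 < α) (hL : α ≤ L) : qPic α L < 1 := by
  have hL0 : 0 < L := hα.trans_le hL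
  rw [qPic, Real.sqrt_lt' one_pos, one_pow]
  have : 0 < α ^ 2 / L ^ 2 := by positivity
  linarith

/-- One exact Banach-Picard step contracts the error by the factor `qPic α L`. -/
theorem norm_sub_picard_le [CompleteSpace V] {B : V → V →L[𝕜] 𝕜} {α L : ℝ}
    (hB : IsMonotoneLipschitz B α L) {G : V →L[𝕜] 𝕜} {U : Submodule 𝕜 V} {u w x : V}
    (hu : u ∈ U ∧ ∀ v ∈ U, B u v = G v)
    (hx : x ∈ U ∧ ∀ v ∈ U, innerSL 𝕜 x v =
      (innerSL 𝕜 w - ((α / L ^ 2 : ℝ) : 𝕜) • (B w - G)) v) :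
    ‖u - x‖ ≤ qPic α L * ‖u - w‖ := by
  have hα := hB.alpha_pos
  have hL : 0 < L := hα.trans_le hB.alpha_le
  have hL2 : α ^ 2 / L ^ 2 ≤ 1 := by
    rw [div_le_one (by positivity)]
    exact pow_le_pow_left₀ hα.le hB.alpha_le 2
  set δ : ℝ := α / L ^ 2 with hδ
  have hδ0 : 0 < δ := by positivity
  set R : V := (InnerProductSpace.toDual 𝕜 V).symm (B u - B w) with hR
  have hRv : ∀ v, inner 𝕜 R v = (B u - B w) v := fun v => by
    rw [hR, InnerProductSpace.toDual_symm_apply]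
  have hRn : ‖R‖ ≤ L * ‖u - w‖ := by
    rw [hR, LinearIsometryEquiv.norm_map]
    exact hB.lipschitz u w
  have he : u - x ∈ U := U.sub_mem hu.1 hx.1
  have key : inner 𝕜 (u - x) (u - x) = inner 𝕜 ((u - w) - (δ : 𝕜) • R) (u - x) := by
    have h1 := hx.2 _ he
    have h2 := hu.2 _ he
    simp only [innerSL_apply_apply, sub_apply, smul_apply,
      smul_eq_mul] at h1
    rw [inner_sub_left (𝕜 := 𝕜) (u - w), inner_smul_left, hRv, inner_sub_left u x, h1,
      inner_sub_left u w, RCLike.conj_ofReal, sub_apply, h2]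
    ring
  have h1 : ‖u - x‖ ^ 2 ≤ ‖(u - w) - (δ : 𝕜) • R‖ * ‖u - x‖ := by
    rw [← inner_self_eq_norm_sq (𝕜 := 𝕜), key]
    exact re_inner_le_norm _ _
  have h2 : ‖(u - w) - (δ : 𝕜) • R‖ ^ 2 ≤ (1 - α ^ 2 / L ^ 2) * ‖u - w‖ ^ 2 := by
    have h2 : α * ‖u - w‖ ^ 2 ≤ RCLike.re (inner 𝕜 R (u - w)) := by
      rw [hRv]
      exact hB.monotone u w
    have h3 : ‖R‖ ^ 2 ≤ L ^ 2 * ‖u - w‖ ^ 2 := by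
      rw [← mul_pow]
      exact pow_le_pow_left₀ (norm_nonneg _) hRn 2
    rw [norm_sub_sq (𝕜 := 𝕜), inner_smul_right, RCLike.re_ofReal_mul, norm_smul,
      RCLike.norm_ofReal, abs_of_pos hδ0, mul_pow, ← inner_conj_symm, RCLike.conj_re]
    have h4 := mul_le_mul_of_nonneg_left h2 hδ0.le
    have h5 := mul_le_mul_of_nonneg_left h3 (sq_nonneg δ)
    have h6 : δ ^ 2 * (L ^ 2 * ‖u - w‖ ^ 2) = α ^ 2 / L ^ 2 * ‖u - w‖ ^ 2 := by
      rw [hδ]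
      field_simp
    have h7 : δ * (α * ‖u - w‖ ^ 2) = α ^ 2 / L ^ 2 * ‖u - w‖ ^ 2 := by
      rw [hδ]
      field_simp
    linarith
  have h3 : ‖(u - w) - (δ : 𝕜) • R‖ ≤ qPic α L * ‖u - w‖ := by
    refine abs_le_of_sq_le_sq' ?_ (mul_nonneg (qPic_nonneg _ _) (norm_nonneg _)) |>.2
    rw [mul_pow, qPic, Real.sq_sqrt (by linarith)]
    exact h2
  by_contra! h
  have h0 : 0 < ‖u - x‖ :=
    (mul_nonneg (qPic_nonneg _ _) (norm_nonneg _)).trans_lt h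
  nlinarith

/-- Céa's lemma. -/
theorem norm_sub_galerkin_le {B : V → V →L[𝕜] 𝕜} {α L : ℝ}
    (hB : IsMonotoneLipschitz B α L) {G : V →L[𝕜] 𝕜} {U : Submodule 𝕜 V} {x u v : V}
    (hx : ∀ v, B x v = G v) (hu : u ∈ U ∧ ∀ v ∈ U, B u v = G v) (hv : v ∈ U) :
    ‖x - u‖ ≤ L / α * ‖x - v‖ := by
  have hα := hB.alpha_pos
  have hm := hB.monotone x u
  have h0 : (B x - B u) (x - u) = (B x - B u) (x - v) := by
    have : (B x - B u) (v - u) = 0 := by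
      rw [sub_apply, hx, hu.2 _ (U.sub_mem hv hu.1), sub_self]
    rw [show x - u = (x - v) + (v - u) by abel, map_add, this, add_zero]
  have h1 : RCLike.re ((B x - B u) (x - v)) ≤ L * ‖x - u‖ * ‖x - v‖ :=
    ((RCLike.re_le_norm _).trans ((B x - B u).le_opNorm _)).trans
      (mul_le_mul_of_nonneg_right (hB.lipschitz x u) (norm_nonneg _))
  rw [h0] at hm
  rw [div_mul_eq_mul_div, le_div_iff₀ hα]
  by_contra! h
  have hL : 0 < L := hα.trans_le hB.alpha_le
  have h2 : 0 < ‖x - u‖ := by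
    have : 0 ≤ L * ‖x - v‖ := by positivity
    by_contra! h3
    nlinarith
  nlinarith

/-- The energy `Re (P v - G v)`, whose minimizer on a subspace is the Galerkin solution. -/
noncomputable def energy (P : V → 𝕜) (G : V →L[𝕜] 𝕜) (v : V) : ℝ :=
  RCLike.re (P v) - RCLike.re (G v)

theorem hasDerivAt_re_potential {B : V → V →L[𝕜] 𝕜} {P : V → 𝕜}
    (hP : ∀ w v : V, Tendsto
      (fun t : ℝ => (RCLike.re (P (w + (t : 𝕜) • v)) - RCLike.re (P w)) / t)
      (𝓝[≠] 0) (𝓝 (RCLike.re (B w v)))) (u z : V) (t : ℝ) :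
    HasDerivAt (fun t : ℝ => RCLike.re (P (u + (t : 𝕜) • z)))
      (RCLike.re (B (u + (t : 𝕜) • z) z)) t := by
  rw [hasDerivAt_iff_tendsto_slope_zero]
  refine (hP (u + (t : 𝕜) • z) z).congr fun r => ?_
  rw [smul_eq_mul, div_eq_inv_mul, RCLike.ofReal_add, add_smul, add_assoc]

/-- The energy difference to the Galerkin solution is equivalent to the squared error. -/
theorem energy_sub_bounds {B : V → V →L[𝕜] 𝕜} {α L : ℝ} (hB : IsMonotoneLipschitz B α L)
    {P : V → 𝕜} (hP : ∀ w v : V, Tendsto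
      (fun t : ℝ => (RCLike.re (P (w + (t : 𝕜) • v)) - RCLike.re (P w)) / t)
      (𝓝[≠] 0) (𝓝 (RCLike.re (B w v)))) {G : V →L[𝕜] 𝕜} {U : Submodule 𝕜 V} {u v : V}
    (hu : u ∈ U ∧ ∀ v ∈ U, B u v = G v) (hv : v ∈ U) :
    α / 2 * ‖v - u‖ ^ 2 ≤ energy P G v - energy P G u ∧
      energy P G v - energy P G u ≤ L / 2 * ‖v - u‖ ^ 2 := by
  set z := v - u with hz
  have hzU : z ∈ U := U.sub_mem hv hu.1
  set g : ℝ → ℝ := fun t => RCLike.re (P (u + (t : 𝕜) • z)) - t * RCLike.re (G z) with hg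
  have hd : ∀ t : ℝ, HasDerivAt g (RCLike.re ((B (u + (t : 𝕜) • z) - B u) z)) t := fun t => by
    have h1 := (hasDerivAt_re_potential hP u z t).sub
      ((hasDerivAt_id t).mul_const (RCLike.re (G z)))
    rw [sub_apply, map_sub, hu.2 z hzU]
    exact h1.congr_deriv (by rw [one_mul])
  have hg0 : g 1 - g 0 = energy P G v - energy P G u := by
    simp only [hg, energy, RCLike.ofReal_one, one_smul, RCLike.ofReal_zero, zero_smul, add_zero,
      hz, add_sub_cancel, map_sub]
    ring
  have hlow : ∀ t : ℝ, 0 < t →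
      α * t * ‖z‖ ^ 2 ≤ RCLike.re ((B (u + (t : 𝕜) • z) - B u) z) := fun t ht => by
    have h1 := hB.monotone (u + (t : 𝕜) • z) u
    rw [add_sub_cancel_left, map_smul, smul_eq_mul, RCLike.re_ofReal_mul, norm_smul,
      RCLike.norm_ofReal, abs_of_pos ht, mul_pow] at h1
    nlinarith
  have hup : ∀ t : ℝ, 0 < t →
      RCLike.re ((B (u + (t : 𝕜) • z) - B u) z) ≤ L * t * ‖z‖ ^ 2 := fun t ht => by
    have h1 := hB.lipschitz (u + (t : 𝕜) • z) u
    rw [add_sub_cancel_left, norm_smul, RCLike.norm_ofReal, abs_of_pos ht] at h1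
    calc _ ≤ ‖B (u + (t : 𝕜) • z) - B u‖ * ‖z‖ :=
          (RCLike.re_le_norm _).trans (ContinuousLinearMap.le_opNorm _ _)
      _ ≤ L * (t * ‖z‖) * ‖z‖ := mul_le_mul_of_nonneg_right h1 (norm_nonneg _)
      _ = _ := by ring
  have hq : ∀ (c t : ℝ), HasDerivAt (fun t : ℝ => c / 2 * t ^ 2 * ‖z‖ ^ 2) (c * t * ‖z‖ ^ 2) t :=
    fun c t => by
      have := ((hasDerivAt_pow 2 t).const_mul (c / 2)).mul_const (‖z‖ ^ 2)
      refine this.congr_deriv ?_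
      push_cast
      ring
  rw [← hg0]
  constructor
  · have hmono : MonotoneOn (fun t => g t - α / 2 * t ^ 2 * ‖z‖ ^ 2) (Set.Icc 0 1) := by
      refine monotoneOn_of_deriv_nonneg (convex_Icc 0 1)
        (fun t _ => ((hd t).sub (hq α t)).continuousAt.continuousWithinAt)
        (fun t _ => ((hd t).sub (hq α t)).differentiableAt.differentiableWithinAt) fun t ht => ?_
      rw [interior_Icc] at ht
      have h2 : deriv (fun t => g t - α / 2 * t ^ 2 * ‖z‖ ^ 2) t = _ := ((hd t).sub (hq α t)).deriv
      rw [h2]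
      linarith [hlow t ht.1]
    have := hmono (Set.left_mem_Icc.2 zero_le_one) (Set.right_mem_Icc.2 zero_le_one) zero_le_one
    simp only at this
    linarith
  · have hmono : MonotoneOn (fun t => L / 2 * t ^ 2 * ‖z‖ ^ 2 - g t) (Set.Icc 0 1) := by
      refine monotoneOn_of_deriv_nonneg (convex_Icc 0 1)
        (fun t _ => ((hq L t).sub (hd t)).continuousAt.continuousWithinAt)
        (fun t _ => ((hq L t).sub (hd t)).differentiableAt.differentiableWithinAt) fun t ht => ?_
      rw [interior_Icc] at ht
      have h2 : deriv (fun t => L / 2 * t ^ 2 * ‖z‖ ^ 2 - g t) t = _ := ((hq L t).sub (hd t)).deriv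
      rw [h2]
      linarith [hup t ht.1]
    have := hmono (Set.left_mem_Icc.2 zero_le_one) (Set.right_mem_Icc.2 zero_le_one) zero_le_one
    simp only at this
    linarith

end Hilbert

namespace Setting

variable {𝕜 V E : Type*} [RCLike 𝕜] [NormedAddCommGroup V] [InnerProductSpace 𝕜 V]
  {D : Setting 𝕜 V E}

/-! ### Estimator and meshes -/

theorem etaOn_nonneg (T S : Finset E) (v : V) : 0 ≤ D.etaOn T S v := Real.sqrt_nonneg _

theorem eta_nonneg (T : Finset E) (v : V) : 0 ≤ D.eta T v := Real.sqrt_nonneg _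

theorem etaOn_sq (T S : Finset E) (v : V) : D.etaOn T S v ^ 2 = ∑ K ∈ S, D.η T K v ^ 2 :=
  Real.sq_sqrt (Finset.sum_nonneg fun _ _ => sq_nonneg _)

theorem etaOn_mono (T : Finset E) {S S' : Finset E} (h : S ⊆ S') (v : V) :
    D.etaOn T S v ≤ D.etaOn T S' v :=
  Real.sqrt_le_sqrt (Finset.sum_le_sum_of_subset_of_nonneg h fun _ _ _ => sq_nonneg _)

theorem etaOn_sq_inter_add_sdiff [DecidableEq E] (T S S' : Finset E) (v : V) :
    D.etaOn T (S ∩ S') v ^ 2 + D.etaOn T (S \ S') v ^ 2 = D.etaOn T S v ^ 2 := by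
  simp only [etaOn_sq]
  exact Finset.sum_inter_add_sum_sdiff S S' _

theorem IsMesh.of_refines {T T' : Finset E} (hT : D.IsMesh T) (h : D.Refines T T') :
    D.IsMesh T' :=
  Relation.ReflTransGen.trans hT h

theorem refines_refine {T M : Finset E} (hM : M ⊆ T) : D.Refines T (D.refine T M) :=
  Relation.ReflTransGen.single ⟨M, hM, rfl⟩

theorem IsRefinement.card_sdiff_add_card_le [DecidableEq E] {Cson Cmesh : ℝ}
    (h : D.IsRefinement Cson Cmesh) {T T' : Finset E} (hT : D.IsMesh T) (hT' : D.Refines T T') :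
    (T \ T').card + T.card ≤ T'.card := by
  induction hT' with
  | refl => simp
  | @tail S S' hS hS' ih =>
    obtain ⟨M, hM, rfl⟩ := hS'
    have h1 := h.card_le_card S (hT.of_refines hS) M hM
    have h2 : (T \ D.refine S M).card ≤ (T \ S).card + (S \ D.refine S M).card := by
      refine (Finset.card_le_card fun x hx => ?_).trans (Finset.card_union_le _ _)
      simp only [Finset.mem_sdiff, Finset.mem_union] at hx ⊢
      tauto
    omega

theorem IsRefinement.card_init_le [DecidableEq E] {Cson Cmesh : ℝ}
    (h : D.IsRefinement Cson Cmesh) {T : Finset E} (hT : D.IsMesh T) : D.T₀.card ≤ T.card := by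
  have := h.card_sdiff_add_card_le Relation.ReflTransGen.refl hT
  omega

variable [DecidableEq E]

/-- The standing assumptions on operator, refinement, spaces, estimator and solver together with
the admissibility of the constants. -/
structure IsAdmissible (D : Setting 𝕜 V E) (Cstab Crel qred Cson Cmesh qalg lamAlgStar : ℝ) :
    Prop where
  const : AdmissibleConstants D.α D.L Cstab Crel qred Cson Cmesh qalg lamAlgStar
  op : D.IsOperator
  mesh : D.IsRefinement Cson Cmesh
  space : D.IsDiscretization
  est : D.IsEstimator Cstab Crel qred
  alg : D.IsContractiveSolver qalg

namespace IsAdmissible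

variable {Cstab Crel qred Cson Cmesh qalg lamAlgStar : ℝ}
  (h : D.IsAdmissible Cstab Crel qred Cson Cmesh qalg lamAlgStar)

include h

theorem completeSpace_X {T : Finset E} (hT : D.IsMesh T) : CompleteSpace (D.X T) :=
  have := h.space.finite T hT
  FiniteDimensional.complete 𝕜 (D.X T)

theorem abs_eta_sub_le {T : Finset E} (hT : D.IsMesh T) {v w : V} (hv : v ∈ D.X T)
    (hw : w ∈ D.X T) {S : Finset E} (hS : S ⊆ T) :
    |D.etaOn T S v - D.etaOn T S w| ≤ Cstab * ‖v - w‖ :=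
  h.est.stability T hT T Relation.ReflTransGen.refl v hv w hw S (by simpa using hS)

theorem etaOn_le_add {T : Finset E} (hT : D.IsMesh T) {v w : V} (hv : v ∈ D.X T)
    (hw : w ∈ D.X T) {S : Finset E} (hS : S ⊆ T) :
    D.etaOn T S v ≤ D.etaOn T S w + Cstab * ‖v - w‖ := by
  have := (abs_le.1 (h.abs_eta_sub_le hT hv hw hS)).2
  linarith

theorem eta_le_add {T : Finset E} (hT : D.IsMesh T) {v w : V} (hv : v ∈ D.X T)
    (hw : w ∈ D.X T) : D.eta T v ≤ D.eta T w + Cstab * ‖v - w‖ :=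
  h.etaOn_le_add hT hv hw (Finset.Subset.refl T)

/-- For a fixed function, refinement reduces the estimator on the refined elements. -/
theorem eta_sq_refines_le {T T' : Finset E} (hT : D.IsMesh T) (hT' : D.Refines T T') {v : V}
    (hv : v ∈ D.X T) :
    D.eta T' v ^ 2 ≤ D.eta T v ^ 2 - (1 - qred ^ 2) * D.etaOn T (T \ T') v ^ 2 := by
  have h1 := etaOn_sq_inter_add_sdiff (D := D) T' T' T v
  have h2 := etaOn_sq_inter_add_sdiff (D := D) T T T' v
  have h3 : D.etaOn T' (T' ∩ T) v = D.etaOn T (T ∩ T') v := by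
    have := h.est.stability T hT T' hT' v (h.space.nested T hT T' hT' hv) v hv (T ∩ T')
      (Finset.Subset.refl _)
    rw [sub_self, norm_zero, mul_zero, abs_nonpos_iff, sub_eq_zero] at this
    rw [Finset.inter_comm, this]
  have h4 := pow_le_pow_left₀ (etaOn_nonneg _ _ _) (h.est.reduction T hT T' hT' v hv) 2
  rw [h3] at h1
  rw [mul_pow] at h4
  unfold eta
  linarith

theorem eta_refines_le {T T' : Finset E} (hT : D.IsMesh T) (hT' : D.Refines T T') {v : V}
    (hv : v ∈ D.X T) : D.eta T' v ≤ D.eta T v := by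
  refine abs_le_of_sq_le_sq' ?_ (eta_nonneg _ _) |>.2
  have h1 := h.eta_sq_refines_le hT hT' hv
  have h2 : qred ^ 2 ≤ 1 := pow_le_one₀ h.const.red_pos.le h.const.red_lt.le
  have := mul_nonneg (sub_nonneg.2 h2) (sq_nonneg (D.etaOn T (T \ T') v))
  linarith

variable [CompleteSpace V]

theorem uStar_spec (v : V) : D.A D.uStar v = D.F v := by
  have : CompleteSpace (⊤ : Submodule 𝕜 V) :=
    (completeSpace_coe_iff_isComplete (s := ((⊤ : Submodule 𝕜 V) : Set V))).2
      (by simpa using isComplete_univ)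
  exact (variationalSol_spec h.op.toIsMonotoneLipschitz D.F ⊤).2 v trivial

theorem uStarOn_spec {T : Finset E} (hT : D.IsMesh T) :
    D.uStarOn T ∈ D.X T ∧ ∀ v ∈ D.X T, D.A (D.uStarOn T) v = D.F v :=
  have := h.completeSpace_X hT
  variationalSol_spec h.op.toIsMonotoneLipschitz D.F (D.X T)

theorem linSol_spec {T : Finset E} (hT : D.IsMesh T) (G : V →L[𝕜] 𝕜) :
    D.linSol T G ∈ D.X T ∧ ∀ v ∈ D.X T, innerSL 𝕜 (D.linSol T G) v = G v :=
  have := h.completeSpace_X hT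
  variationalSol_spec isMonotoneLipschitz_innerSL G (D.X T)

theorem norm_uStarOn_sub_linSol_le {T : Finset E} (hT : D.IsMesh T) (w : V) :
    ‖D.uStarOn T - D.linSol T (D.picardRhs w)‖ ≤ qPic D.α D.L * ‖D.uStarOn T - w‖ :=
  norm_sub_picard_le h.op.toIsMonotoneLipschitz (h.uStarOn_spec hT) (h.linSol_spec hT _)

theorem norm_uStar_sub_uStarOn_le {T : Finset E} (hT : D.IsMesh T) {v : V} (hv : v ∈ D.X T) :
    ‖D.uStar - D.uStarOn T‖ ≤ D.L / D.α * ‖D.uStar - v‖ :=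
  norm_sub_galerkin_le h.op.toIsMonotoneLipschitz h.uStar_spec (h.uStarOn_spec hT) hv

/-- Quasi-monotonicity of the estimator at the exact discrete solutions. -/
theorem eta_uStarOn_refines_le {T T' : Finset E} (hT : D.IsMesh T) (hT' : D.Refines T T') :
    D.eta T' (D.uStarOn T') ≤ (1 + Cstab * Crel) * D.eta T (D.uStarOn T) := by
  have hm := hT.of_refines hT'
  have hu := (h.uStarOn_spec hT).1
  have h1 := h.eta_le_add hm (h.uStarOn_spec hm).1 (h.space.nested T hT T' hT' hu)
  have h2 := h.eta_refines_le hT hT' hu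
  have h3 := h.est.discrete_reliability T hT T' hT'
  have h4 : D.etaOn T (T \ T') (D.uStarOn T) ≤ D.eta T (D.uStarOn T) :=
    etaOn_mono T Finset.sdiff_subset _
  have h5 := mul_le_mul_of_nonneg_left
    (h3.trans (mul_le_mul_of_nonneg_left h4 h.const.rel_pos.le)) h.const.stab_pos.le
  linarith

end IsAdmissible

end Setting

/-! ### Linear convergence of the exact discrete solutions -/

/-- Reduction of the squared estimator under Dörfler marking with parameter `t`. -/
noncomputable def redFactor (qred t : ℝ) : ℝ := 1 - (1 - qred ^ 2) * t ^ 2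

/-- Weight of the energy in the Lyapunov functional `estimator² + weight * energy error`. -/
noncomputable def energyWeight (α Cstab qred t : ℝ) : ℝ :=
  (1 + 2 / (1 - redFactor qred t)) * Cstab ^ 2 * (2 / α)

/-- Upper bound for the quotient of the Lyapunov functional and the squared estimator. -/
noncomputable def lyapRatio (α L Cstab Crel qred t : ℝ) : ℝ :=
  1 + energyWeight α Cstab qred t * (L / 2 * Crel ^ 2)

/-- Contraction factor of the Lyapunov functional. -/
noncomputable def lyapRate (α L Cstab Crel qred t : ℝ) : ℝ :=
  1 - (1 - redFactor qred t) / 2 / lyapRatio α L Cstab Crel qred t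

theorem redFactor_mem {qred t : ℝ} (hq : 0 < qred) (hq1 : qred < 1) (ht : 0 < t) (ht1 : t ≤ 1) :
    0 < redFactor qred t ∧ redFactor qred t < 1 := by
  have h1 : qred ^ 2 < 1 := pow_lt_one₀ hq.le hq1 two_ne_zero
  have h2 : t ^ 2 ≤ 1 := pow_le_one₀ ht.le ht1
  have h3 : 0 < t ^ 2 := by positivity
  have h4 : 0 < qred ^ 2 := by positivity
  unfold redFactor
  constructor <;> nlinarith

theorem energyWeight_pos {α Cstab qred t : ℝ} (hα : 0 < α) (hC : 0 < Cstab) (hq : 0 < qred)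
    (hq1 : qred < 1) (ht : 0 < t) (ht1 : t ≤ 1) : 0 < energyWeight α Cstab qred t := by
  have := sub_pos.2 (redFactor_mem hq hq1 ht ht1).2
  unfold energyWeight
  positivity

theorem one_le_lyapRatio {α L Cstab Crel qred t : ℝ} (hα : 0 < α) (hL : 0 < L) (hC : 0 < Cstab)
    (hq : 0 < qred) (hq1 : qred < 1) (ht : 0 < t) (ht1 : t ≤ 1) :
    1 ≤ lyapRatio α L Cstab Crel qred t := by
  have := energyWeight_pos hα hC hq hq1 ht ht1
  have : 0 ≤ energyWeight α Cstab qred t * (L / 2 * Crel ^ 2) := by positivity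
  unfold lyapRatio
  linarith

theorem lyapRate_mem {α L Cstab Crel qred t : ℝ} (hα : 0 < α) (hL : 0 < L) (hC : 0 < Cstab)
    (hq : 0 < qred) (hq1 : qred < 1) (ht : 0 < t) (ht1 : t ≤ 1) :
    0 < lyapRate α L Cstab Crel qred t ∧ lyapRate α L Cstab Crel qred t < 1 := by
  have h1 := one_le_lyapRatio (Crel := Crel) hα hL hC hq hq1 ht ht1
  have h2 := redFactor_mem hq hq1 ht ht1
  have h3 : 0 < (1 - redFactor qred t) / 2 / lyapRatio α L Cstab Crel qred t :=
    div_pos (by linarith) (by linarith)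
  have h4 : (1 - redFactor qred t) / 2 / lyapRatio α L Cstab Crel qred t < 1 := by
    rw [div_lt_one (by linarith)]
    linarith
  unfold lyapRate
  constructor <;> linarith

namespace Setting

variable {𝕜 V E : Type*} [RCLike 𝕜] [NormedAddCommGroup V] [InnerProductSpace 𝕜 V]
  {D : Setting 𝕜 V E}

/-- The Lyapunov functional `η_T(u_T⋆)² + weight * (energy of u_T⋆ - energy of u⋆)`. -/
noncomputable def lyap (D : Setting 𝕜 V E) (Cstab qred t : ℝ) (T : Finset E) : ℝ :=
  D.eta T (D.uStarOn T) ^ 2 + energyWeight D.α Cstab qred t *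
    (energy D.P D.F (D.uStarOn T) - energy D.P D.F D.uStar)

namespace IsAdmissible

variable [CompleteSpace V] [DecidableEq E] {Cstab Crel qred Cson Cmesh qalg lamAlgStar : ℝ}
  (h : D.IsAdmissible Cstab Crel qred Cson Cmesh qalg lamAlgStar)

include h

theorem energy_uStar_bounds {T : Finset E} (hT : D.IsMesh T) :
    0 ≤ energy D.P D.F (D.uStarOn T) - energy D.P D.F D.uStar ∧
    energy D.P D.F (D.uStarOn T) - energy D.P D.F D.uStar ≤
      D.L / 2 * Crel ^ 2 * D.eta T (D.uStarOn T) ^ 2 := by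
  have h1 := energy_sub_bounds h.op.toIsMonotoneLipschitz h.op.gateaux (U := ⊤)
    ⟨trivial, fun v _ => h.uStar_spec v⟩ (v := D.uStarOn T) trivial
  have hα := h.const.alpha_pos
  have hL : 0 < D.L := hα.trans_le h.const.alpha_le
  have h2 := pow_le_pow_left₀ (norm_nonneg _) (h.est.reliability T hT) 2
  rw [norm_sub_rev, mul_pow] at h2
  refine ⟨le_trans (by positivity) h1.1, h1.2.trans ?_⟩
  rw [mul_assoc]
  exact mul_le_mul_of_nonneg_left h2 (by positivity)

theorem lyap_bounds {t : ℝ} (ht : 0 < t) (ht1 : t ≤ 1) {T : Finset E} (hT : D.IsMesh T) :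
    D.eta T (D.uStarOn T) ^ 2 ≤ D.lyap Cstab qred t T ∧
    D.lyap Cstab qred t T ≤
      lyapRatio D.α D.L Cstab Crel qred t * D.eta T (D.uStarOn T) ^ 2 := by
  have h1 := h.energy_uStar_bounds hT
  have h2 := energyWeight_pos h.const.alpha_pos h.const.stab_pos h.const.red_pos h.const.red_lt
    ht ht1
  have h3 := mul_nonneg h2.le h1.1
  have h4 := mul_le_mul_of_nonneg_left h1.2 h2.le
  unfold lyap lyapRatio
  constructor <;> linarith

/-- If the refined elements satisfy the Dörfler criterion for the exact discrete solution, then the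
Lyapunov functional contracts: estimator reduction perturbed by `‖u_T'⋆ - u_T⋆‖²`, which the
energy difference controls, so that the perturbation telescopes. -/
theorem lyap_contract {t : ℝ} (ht : 0 < t) (ht1 : t ≤ 1) {T T' : Finset E} (hT : D.IsMesh T)
    (hT' : D.Refines T T')
    (hD : t * D.eta T (D.uStarOn T) ≤ D.etaOn T (T \ T') (D.uStarOn T)) :
    D.lyap Cstab qred t T' ≤
      lyapRate D.α D.L Cstab Crel qred t * D.lyap Cstab qred t T := by
  have hα := h.const.alpha_pos
  have hL : 0 < D.L := hα.trans_le h.const.alpha_le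
  have hm := hT.of_refines hT'
  have hu := (h.uStarOn_spec hT).1
  have hu' := h.space.nested T hT T' hT' hu
  have hr := redFactor_mem h.const.red_pos h.const.red_lt ht ht1
  set r := redFactor qred t with hrdef
  set a := D.eta T (D.uStarOn T) with ha
  set a' := D.eta T' (D.uStarOn T') with ha'
  set d := ‖D.uStarOn T' - D.uStarOn T‖ with hd
  have h1 : D.eta T' (D.uStarOn T) ^ 2 ≤ r * a ^ 2 := by
    have h1 := h.eta_sq_refines_le hT hT' hu
    have h2 := pow_le_pow_left₀ (mul_nonneg ht.le (eta_nonneg _ _)) hD 2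
    have h3 : 0 ≤ 1 - qred ^ 2 :=
      sub_nonneg.2 (pow_le_one₀ h.const.red_pos.le h.const.red_lt.le)
    have h4 := mul_le_mul_of_nonneg_left h2 h3
    rw [hrdef, redFactor]
    rw [mul_pow] at h4
    linarith
  have h2 : a' ≤ D.eta T' (D.uStarOn T) + Cstab * d := h.eta_le_add hm (h.uStarOn_spec hm).1 hu'
  have h3 : a' ^ 2 ≤ (1 + (1 - r) / 2) * D.eta T' (D.uStarOn T) ^ 2 +
      (1 + 2 / (1 - r)) * (Cstab * d) ^ 2 := by
    refine (pow_le_pow_left₀ (eta_nonneg _ _) h2 2).trans ?_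
    set x := D.eta T' (D.uStarOn T)
    set y := Cstab * d
    -- Young's inequality with weight `(1 - r) / 2`
    have hr1 : 0 < 1 - r := by linarith [hr.2]
    have : (1 + (1 - r) / 2) * x ^ 2 + (1 + 2 / (1 - r)) * y ^ 2 - (x + y) ^ 2 =
        ((1 - r) * x - 2 * y) ^ 2 / (2 * (1 - r)) := by
      field_simp
      ring
    have h5 : 0 ≤ ((1 - r) * x - 2 * y) ^ 2 / (2 * (1 - r)) := by positivity
    linarith
  have h4 : D.α / 2 * d ^ 2 ≤
      energy D.P D.F (D.uStarOn T) - energy D.P D.F (D.uStarOn T') := by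
    have := (energy_sub_bounds h.op.toIsMonotoneLipschitz h.op.gateaux (h.uStarOn_spec hm) hu').1
    rwa [norm_sub_rev] at this
  have h5 : (1 + 2 / (1 - r)) * (Cstab * d) ^ 2 ≤ energyWeight D.α Cstab qred t *
      (energy D.P D.F (D.uStarOn T) - energy D.P D.F (D.uStarOn T')) := by
    have hw := energyWeight_pos hα h.const.stab_pos h.const.red_pos h.const.red_lt ht ht1
    refine le_trans (le_of_eq ?_) (mul_le_mul_of_nonneg_left h4 hw.le)
    rw [energyWeight, ← hrdef]
    field_simp
  have h6 : (1 + (1 - r) / 2) * D.eta T' (D.uStarOn T) ^ 2 ≤ (1 - (1 - r) / 2) * a ^ 2 := by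
    have h7 := mul_le_mul_of_nonneg_left h1 (show 0 ≤ 1 + (1 - r) / 2 by linarith [hr.2])
    have h8 : (1 + (1 - r) / 2) * r ≤ 1 - (1 - r) / 2 := by nlinarith [hr.1, hr.2]
    have h9 := mul_le_mul_of_nonneg_right h8 (sq_nonneg a)
    linarith
  have h7 := (h.lyap_bounds ht ht1 hT).2
  have hk := one_le_lyapRatio (Crel := Crel) hα hL h.const.stab_pos h.const.red_pos h.const.red_lt
    ht ht1
  set k := lyapRatio D.α D.L Cstab Crel qred t
  have h8 : (1 - r) / 2 / k * D.lyap Cstab qred t T ≤ (1 - r) / 2 * a ^ 2 := by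
    rw [div_mul_eq_mul_div, div_le_iff₀ (by linarith)]
    have := mul_le_mul_of_nonneg_left h7 (show 0 ≤ (1 - r) / 2 by linarith [hr.2])
    linarith
  have h9 : lyapRate D.α D.L Cstab Crel qred t = 1 - (1 - r) / 2 / k := rfl
  rw [h9, sub_mul, one_mul]
  have e1 : D.lyap Cstab qred t T = a ^ 2 + energyWeight D.α Cstab qred t *
    (energy D.P D.F (D.uStarOn T) - energy D.P D.F D.uStar) := rfl
  have e2 : D.lyap Cstab qred t T' = a' ^ 2 + energyWeight D.α Cstab qred t *
    (energy D.P D.F (D.uStarOn T') - energy D.P D.F D.uStar) := rfl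
  rw [e1] at h8 ⊢
  rw [e2]
  linarith

end IsAdmissible

end Setting

/-! ### Optimality of Dörfler marking -/

/-- Estimator reduction by this factor forces the refined elements to satisfy the Dörfler
criterion with parameter `t`. -/
noncomputable def optFactor (Cstab Crel t : ℝ) : ℝ := (1 - t) / (2 * (1 + 2 * (Cstab * Crel)))

theorem thetaOpt_pos (Cstab Crel : ℝ) : 0 < thetaOpt Cstab Crel := by
  unfold thetaOpt
  positivity

theorem thetaOpt_le_one (Cstab Crel : ℝ) : thetaOpt Cstab Crel ≤ 1 := by
  unfold thetaOpt
  exact inv_le_one_of_one_le₀ (by nlinarith [sq_nonneg (Cstab * Crel)])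

theorem optFactor_mem {Cstab Crel t : ℝ} (hs : 0 < Cstab) (hr : 0 < Crel) (ht : 0 < t)
    (ht1 : t < thetaOpt Cstab Crel) :
    0 < optFactor Cstab Crel t ∧ optFactor Cstab Crel t < 1 := by
  have h1 := ht1.trans_le (thetaOpt_le_one _ _)
  have h2 : 0 < Cstab * Crel := mul_pos hs hr
  unfold optFactor
  refine ⟨div_pos (by linarith) (by linarith), ?_⟩
  rw [div_lt_one (by linarith)]
  linarith

namespace Setting.IsAdmissible

variable {𝕜 V E : Type*} [RCLike 𝕜] [NormedAddCommGroup V] [InnerProductSpace 𝕜 V]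
  {D : Setting 𝕜 V E} [CompleteSpace V] [DecidableEq E]
  {Cstab Crel qred Cson Cmesh qalg lamAlgStar : ℝ}
  (h : D.IsAdmissible Cstab Crel qred Cson Cmesh qalg lamAlgStar)

include h

theorem doerfler_of_eta_le {t : ℝ} (ht : 0 < t) (ht1 : t < thetaOpt Cstab Crel)
    {T T' : Finset E} (hT : D.IsMesh T) (hT' : D.Refines T T')
    (hle : D.eta T' (D.uStarOn T') ≤ optFactor Cstab Crel t * D.eta T (D.uStarOn T)) :
    t * D.eta T (D.uStarOn T) ≤ D.etaOn T (T \ T') (D.uStarOn T) := by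
  have hm := hT.of_refines hT'
  have hκ := optFactor_mem h.const.stab_pos h.const.rel_pos ht ht1
  have hc : 0 < Cstab * Crel := mul_pos h.const.stab_pos h.const.rel_pos
  set κ := optFactor Cstab Crel t with hκdef
  set c := Cstab * Crel with hcdef
  set a := D.eta T (D.uStarOn T) with ha
  set ρ := D.etaOn T (T \ T') (D.uStarOn T) with hρ
  have ha0 : 0 ≤ a := eta_nonneg _ _
  have hρ0 : 0 ≤ ρ := etaOn_nonneg _ _ _
  have ht1' := ht1.trans_le (thetaOpt_le_one _ _)
  have hpyth : D.etaOn T (T ∩ T') (D.uStarOn T) ^ 2 + ρ ^ 2 = a ^ 2 :=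
    etaOn_sq_inter_add_sdiff T T T' _
  have h1 : D.etaOn T (T ∩ T') (D.uStarOn T) ≤ κ * a + c * ρ := by
    have h1 := h.est.stability T hT T' hT' _ (h.uStarOn_spec hm).1 _ (h.uStarOn_spec hT).1
      (T ∩ T') (Finset.Subset.refl _)
    have h2 := (abs_le.1 h1).1
    have h3 : D.etaOn T' (T ∩ T') (D.uStarOn T') ≤ D.eta T' (D.uStarOn T') :=
      etaOn_mono T' Finset.inter_subset_right _
    have h4 := mul_le_mul_of_nonneg_left (h.est.discrete_reliability T hT T' hT')
      h.const.stab_pos.le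
    rw [← mul_assoc] at h4
    linarith
  by_contra! hlt
  have ha1 : 0 < a := by
    by_contra! h0
    nlinarith
  have h2 : κ * a + c * ρ ≤ (κ + c * t) * a := by nlinarith
  have h3 : a ^ 2 < ((κ + c * t) ^ 2 + t ^ 2) * a ^ 2 := by
    have h4 := pow_le_pow_left₀ (etaOn_nonneg _ _ _) (h1.trans h2) 2
    have h5 := pow_lt_pow_left₀ hlt hρ0 two_ne_zero
    rw [mul_pow] at h4 h5
    linarith
  have h4 : (κ + c * t) ^ 2 + t ^ 2 < 1 := by
    have h5 : t * (1 + c ^ 2) < 1 := by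
      have := mul_lt_mul_of_pos_right ht1 (show 0 < 1 + c ^ 2 by positivity)
      rwa [thetaOpt, ← mul_pow, ← hcdef, inv_mul_cancel₀ (by positivity)] at this
    have h6 : κ * (1 + 2 * c) = (1 - t) / 2 := by
      rw [hκdef, optFactor, ← hcdef]
      field_simp
    have h7 : κ ^ 2 + 2 * κ * c * t ≤ κ * (1 + 2 * c) := by
      have : κ * c * t ≤ κ * c := mul_le_of_le_one_right (by nlinarith) ht1'.le
      nlinarith
    nlinarith
  nlinarith [sq_pos_of_pos ha1]

/-- Comparison with the best mesh of the approximation class: some `R` satisfies the Dörfler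
criterion for the exact discrete solution on `T`, with `#R` bounded by the approximation norm. The
overlay of `T` with an almost optimal mesh of accuracy `optFactor / (1 + Cstab Crel) * η_T(u_T⋆)`
provides `R`. -/
theorem exists_doerfler_card_le {t : ℝ} (ht : 0 < t) (ht1 : t < thetaOpt Cstab Crel)
    {s : ℝ} (hs : 0 < s) {A : ℝ} (hA : 0 ≤ A) (happrox : D.approxNorm s ≤ ENNReal.ofReal A)
    {T : Finset E} (hT : D.IsMesh T) (hpos : 0 < D.eta T (D.uStarOn T)) :
    ∃ R ⊆ T, t * D.eta T (D.uStarOn T) ≤ D.etaOn T R (D.uStarOn T) ∧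
      (R.card : ℝ) ^ s *
        (optFactor Cstab Crel t / (1 + Cstab * Crel) * D.eta T (D.uStarOn T)) ≤ A := by
  have hκ := optFactor_mem h.const.stab_pos h.const.rel_pos ht ht1
  have hc : 0 < Cstab * Crel := mul_pos h.const.stab_pos h.const.rel_pos
  set ε := optFactor Cstab Crel t / (1 + Cstab * Crel) * D.eta T (D.uStarOn T) with hε
  have hε0 : 0 < ε := mul_pos (div_pos hκ.1 (by linarith)) hpos
  set b : ℕ → ℝ≥0∞ := fun N => ⨅ (S : Finset E)
    (_ : D.IsMesh S ∧ (S.card : ℝ) - D.T₀.card ≤ N),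
      ENNReal.ofReal (‖D.uStar - D.uStarOn S‖ + D.eta S (D.uStarOn S)) with hb
  have hbA : ∀ N : ℕ, ENNReal.ofReal (((N : ℝ) + 1) ^ s) * b N ≤ ENNReal.ofReal A := fun N =>
    (le_iSup (fun N : ℕ => ENNReal.ofReal (((N : ℝ) + 1) ^ s) * b N) N).trans happrox
  have hle : ∀ N : ℕ, ENNReal.ofReal ε ≤ b N → ((N : ℝ) + 1) ^ s * ε ≤ A := fun N hN => by
    rw [← ENNReal.ofReal_le_ofReal_iff hA, ENNReal.ofReal_mul (by positivity)]
    exact (mul_le_mul_right hN _).trans (hbA N)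
  have hex : ∃ N : ℕ, b N < ENNReal.ofReal ε := by
    by_contra! hcon
    have htend : Tendsto (fun N : ℕ => ((N : ℝ) + 1) ^ s) atTop atTop :=
      (tendsto_rpow_atTop hs).comp
        (tendsto_natCast_atTop_atTop.atTop_add tendsto_const_nhds)
    obtain ⟨N, hN⟩ := (htend.eventually (eventually_gt_atTop (A / ε))).exists
    rw [div_lt_iff₀ hε0] at hN
    exact absurd (hle N (hcon N)) (not_le.2 hN)
  obtain ⟨N, hN, hmin⟩ : ∃ N : ℕ, b N < ENNReal.ofReal ε ∧ ∀ m < N, ENNReal.ofReal ε ≤ b m := by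
    classical
    exact ⟨Nat.find hex, Nat.find_spec hex, fun m hm => not_lt.1 (Nat.find_min hex hm)⟩
  simp only [hb, iInf_lt_iff] at hN
  obtain ⟨S, ⟨hS, hScard⟩, hSε⟩ := hN
  rw [ENNReal.ofReal_lt_ofReal_iff hε0] at hSε
  obtain ⟨T', hTT', hST', hcard⟩ := h.mesh.overlay D.T₀ Relation.ReflTransGen.refl T S hT hS
  refine ⟨T \ T', Finset.sdiff_subset, h.doerfler_of_eta_le ht ht1 hT hTT' ?_, ?_⟩
  · refine (h.eta_uStarOn_refines_le hS hST').trans ?_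
    have h1 : D.eta S (D.uStarOn S) ≤ ε := by linarith [norm_nonneg (D.uStar - D.uStarOn S)]
    refine (mul_le_mul_of_nonneg_left h1 (by linarith)).trans (le_of_eq ?_)
    rw [hε]
    field_simp
  · have hR : (T \ T').card ≤ N := by
      have h1 := h.mesh.card_sdiff_add_card_le hT hTT'
      have h2 : S.card ≤ N + D.T₀.card := by
        have : (S.card : ℝ) ≤ ((N + D.T₀.card : ℕ) : ℝ) := by push_cast; linarith
        exact_mod_cast this
      omega
    rcases Nat.eq_zero_or_pos N with h0 | h0
    · have : (T \ T').card = 0 := by omega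
      rw [this, Nat.cast_zero, Real.zero_rpow hs.ne', zero_mul]
      exact hA
    · have h1 := hle (N - 1) (hmin _ (by omega))
      refine le_trans (mul_le_mul_of_nonneg_right ?_ hε0.le) h1
      refine Real.rpow_le_rpow (Nat.cast_nonneg _) ?_ hs.le
      have : (T \ T').card ≤ N - 1 + 1 := by omega
      exact_mod_cast this

end Setting.IsAdmissible

/-! ### Constants of the inexact solver -/

/-- The constant `K` with `‖u_ℓ⋆ - u‖ ≤ K * η_ℓ(u)` for the final iterate `u` on a level. -/
noncomputable def finalConst (qpic qalg lamAlg lamPic : ℝ) : ℝ :=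
  (1 + qpic / (1 - qpic)) * (qalg / (1 - qalg)) * lamAlg +
    (qpic / (1 - qpic) + (1 + qpic / (1 - qpic)) * (qalg / (1 - qalg)) * lamAlg) * lamPic

theorem thetaPrime_eq (Cstab qpic qalg lamAlgStar θ lamAlg lamPic : ℝ) :
    thetaPrime Cstab qpic qalg lamAlgStar θ lamAlg lamPic =
      (θ + Cstab * finalConst qpic qalg lamAlg lamPic) /
        (1 - lamPic / lamPicStar Cstab qpic qalg lamAlgStar) := rfl

/-- The Dörfler parameter that the exact discrete solution inherits from the final iterate. -/
noncomputable def exactTheta (Cstab K θ : ℝ) : ℝ := (θ - Cstab * K) / (1 + Cstab * K)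

section Constants

variable {α L Cstab Crel qred Cson Cmesh qalg lamAlgStar θ lamAlg lamPic : ℝ}

namespace AdmissibleConstants

variable (hc : AdmissibleConstants α L Cstab Crel qred Cson Cmesh qalg lamAlgStar)

include hc

theorem qPic_lt : qPic α L < 1 := qPic_lt_one hc.alpha_pos hc.alpha_le

theorem Calg_pos : 0 < qalg / (1 - qalg) := div_pos hc.alg_pos (sub_pos.2 hc.alg_lt)

theorem qPicPert_denom_pos : 0 < 1 - qalg / (1 - qalg) * lamAlgStar := by
  have h1 := mul_pos hc.Calg_pos hc.star_pos
  have h2 := qPic_nonneg α L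
  by_contra! h3
  have h4 : qPicPert (qPic α L) qalg lamAlgStar ≤ 0 := by
    unfold qPicPert
    exact div_nonpos_of_nonneg_of_nonpos (by linarith) h3
  linarith [hc.pert_pos]

theorem two_mul_Calg_lt : 0 < 1 - qPic α L - 2 * (qalg / (1 - qalg) * lamAlgStar) := by
  have h1 := hc.pert_lt
  rw [qPicPert, div_lt_one hc.qPicPert_denom_pos] at h1
  linarith

theorem lamPicStar_pos : 0 < lamPicStar Cstab (qPic α L) qalg lamAlgStar :=
  div_pos (sub_pos.2 hc.pert_lt) (mul_pos hc.pert_pos hc.stab_pos)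

theorem div_lamPicStar (lamPic : ℝ) : lamPic / lamPicStar Cstab (qPic α L) qalg lamAlgStar =
    Cstab * (lamPic * (qPic α L + qalg / (1 - qalg) * lamAlgStar) /
      (1 - qPic α L - 2 * (qalg / (1 - qalg) * lamAlgStar))) := by
  have h1 := hc.qPicPert_denom_pos
  have h2 := hc.two_mul_Calg_lt
  have h3 := hc.stab_pos
  have h4 : 0 < qPic α L + qalg / (1 - qalg) * lamAlgStar :=
    add_pos_of_nonneg_of_pos (qPic_nonneg _ _) (mul_pos hc.Calg_pos hc.star_pos)
  unfold lamPicStar qPicPert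
  set x := qalg / (1 - qalg) * lamAlgStar
  set q := qPic α L
  have h5 : 1 - (q + x) / (1 - x) = (1 - q - 2 * x) / (1 - x) := by
    field_simp
    ring
  rw [h5]
  field_simp

end AdmissibleConstants

variable (hc : AdmissibleConstants α L Cstab Crel qred Cson Cmesh qalg lamAlgStar)
  (hp : AdmissibleParameters lamAlgStar (lamPicStar Cstab (qPic α L) qalg lamAlgStar)
    θ lamAlg lamPic)

include hc hp

theorem finalConst_pos : 0 < finalConst (qPic α L) qalg lamAlg lamPic := by
  have h1 := hc.Calg_pos
  have h2 : 0 ≤ qPic α L / (1 - qPic α L) :=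
    div_nonneg (qPic_nonneg _ _) (sub_nonneg.2 hc.qPic_lt.le)
  have h3 := hp.alg_pos
  have h4 := hp.pic_pos
  unfold finalConst
  positivity

theorem div_lamPicStar_lt : lamPic / lamPicStar Cstab (qPic α L) qalg lamAlgStar < θ := by
  have h1 := hp.pic_small
  rw [div_lt_iff₀ hp.theta_pos] at h1
  rw [div_lt_iff₀ hc.lamPicStar_pos]
  linarith

theorem stab_mul_finalConst_le : Cstab * finalConst (qPic α L) qalg lamAlg lamPic ≤
    lamPic / lamPicStar Cstab (qPic α L) qalg lamAlgStar := by
  have h0 := hc.Calg_pos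
  have hq0 := qPic_nonneg α L
  have hq1 := hc.qPic_lt
  have h2 := hc.two_mul_Calg_lt
  have hl := hp.pic_pos
  have hs := hp.alg_small
  have h3 : lamAlg * (1 + lamPic) ≤ lamAlgStar * lamPic := by
    have h4 : (lamAlg + lamAlg / lamPic) * lamPic = lamAlg * (1 + lamPic) := by
      field_simp
      ring
    have := mul_lt_mul_of_pos_right hs hl
    linarith
  rw [hc.div_lamPicStar]
  refine mul_le_mul_of_nonneg_left ?_ hc.stab_pos.le
  set q := qPic α L
  have h5 : finalConst q qalg lamAlg lamPic =
      (qalg / (1 - qalg) * (lamAlg * (1 + lamPic)) + q * lamPic) / (1 - q) := by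
    have : 1 - q ≠ 0 := by linarith
    unfold finalConst
    generalize qalg / (1 - qalg) = c
    field_simp
    ring
  have hx : 0 < qalg / (1 - qalg) * lamAlgStar := mul_pos h0 hc.star_pos
  have h6 := mul_le_mul_of_nonneg_left h3 h0.le
  rw [h5]
  set x := qalg / (1 - qalg) * lamAlgStar with hxdef
  refine div_le_div₀ (by positivity) ?_ h2 (by linarith)
  nlinarith

theorem stab_mul_finalConst_lt : Cstab * finalConst (qPic α L) qalg lamAlg lamPic < θ :=
  (stab_mul_finalConst_le hc hp).trans_lt (div_lamPicStar_lt hc hp)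

theorem thetaPrime_pos :
    0 < thetaPrime Cstab (qPic α L) qalg lamAlgStar θ lamAlg lamPic := by
  have h1 := div_lamPicStar_lt hc hp
  have h2 := mul_pos hc.stab_pos (finalConst_pos hc hp)
  rw [thetaPrime_eq]
  exact div_pos (by linarith [hp.theta_pos]) (by linarith [hp.theta_le])

/-- As `Cstab * K` and `λ_Pic / λ_Pic⋆` are smaller than `θ`, `θ'` is smaller than
`2 θ / (1 - θ)`. -/
theorem thetaPrime_lt_thetaOpt
    (hθ : θ < thetaOpt Cstab Crel / (2 + thetaOpt Cstab Crel)) :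
    thetaPrime Cstab (qPic α L) qalg lamAlgStar θ lamAlg lamPic < thetaOpt Cstab Crel := by
  have h1 := div_lamPicStar_lt hc hp
  have h2 := stab_mul_finalConst_lt hc hp
  have ho := thetaOpt_pos Cstab Crel
  rw [lt_div_iff₀ (by linarith)] at hθ
  rw [thetaPrime_eq, div_lt_iff₀ (by linarith [hp.theta_le])]
  nlinarith

theorem exactTheta_mem :
    0 < exactTheta Cstab (finalConst (qPic α L) qalg lamAlg lamPic) θ ∧
    exactTheta Cstab (finalConst (qPic α L) qalg lamAlg lamPic) θ ≤ 1 := by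
  have h1 := stab_mul_finalConst_lt hc hp
  have h2 := mul_pos hc.stab_pos (finalConst_pos hc hp)
  unfold exactTheta
  refine ⟨div_pos (by linarith) (by linarith), ?_⟩
  rw [div_le_one (by linarith)]
  linarith [hp.theta_le]

end Constants

namespace Setting

variable {𝕜 V E : Type*} [RCLike 𝕜] [NormedAddCommGroup V] [InnerProductSpace 𝕜 V]
  {D : Setting 𝕜 V E} {I : Iterates V E} {lamAlg lamPic : ℝ}

/-! ### Index set of the algorithm -/

/-- `(ℓ, k, j)` is the last index on level `ℓ`: both stopping criteria hold. -/
structure IsFinal (D : Setting 𝕜 V E) (lamAlg lamPic : ℝ) (I : Iterates V E) (ℓ k j : ℕ) :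
    Prop where
  one_le_k : 1 ≤ k
  one_le_j : 1 ≤ j
  used : D.Used lamAlg lamPic I ℓ k j
  algStop : D.AlgStop lamAlg I ℓ k j
  picStop : D.PicStop lamPic I ℓ k j

theorem Used.j_eq_zero {ℓ k j : ℕ} (hu : D.Used lamAlg lamPic I ℓ k j) (hk : k = 0) : j = 0 := by
  cases hu <;> first | rfl | omega

theorem Used.level {ℓ k j : ℕ} (hu : D.Used lamAlg lamPic I ℓ k j) :
    D.Used lamAlg lamPic I ℓ 0 0 := by
  induction hu with
  | start => exact .start
  | first_picard ℓ h ih => exact ih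
  | first_alg ℓ k hk h ih => exact ih
  | next_alg ℓ k j hk hj h hs ih => exact ih
  | next_picard ℓ k j hk hj h hs hp ih => exact ih
  | next_mesh ℓ k j hk hj h hs hp he ih => exact .next_mesh ℓ k j hk hj h hs hp he

theorem Used.first {ℓ k j : ℕ} (hu : D.Used lamAlg lamPic I ℓ k j) :
    D.Used lamAlg lamPic I ℓ k 0 := by
  induction hu with
  | start => exact .start
  | first_picard ℓ h ih => exact .first_picard ℓ h
  | first_alg ℓ k hk h ih => exact ih
  | next_alg ℓ k j hk hj h hs ih => exact ih
  | next_picard ℓ k j hk hj h hs hp ih => exact .next_picard ℓ k j hk hj h hs hp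
  | next_mesh ℓ k j hk hj h hs hp he ih => exact .next_mesh ℓ k j hk hj h hs hp he

theorem Used.prev {ℓ k j : ℕ} (hu : D.Used lamAlg lamPic I ℓ k (j + 1)) :
    D.Used lamAlg lamPic I ℓ k j := by
  cases hu with
  | first_alg _ _ hk h => exact h
  | next_alg _ _ _ hk hj h hs => exact h

theorem Used.picard_pred {ℓ k : ℕ} (hu : D.Used lamAlg lamPic I ℓ (k + 2) 0) :
    ∃ j, 1 ≤ j ∧ D.Used lamAlg lamPic I ℓ (k + 1) j ∧ D.AlgStop lamAlg I ℓ (k + 1) j ∧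
      ¬ D.PicStop lamPic I ℓ (k + 1) j := by
  cases hu with
  | next_picard _ _ j hk hj h hs hp => exact ⟨j, hj, h, hs, hp⟩

theorem Used.mesh_pred {ℓ : ℕ} (hu : D.Used lamAlg lamPic I (ℓ + 1) 0 0) :
    ∃ k j, D.IsFinal lamAlg lamPic I ℓ k j ∧ D.eta (I.mesh ℓ) (I.u ℓ k j) ≠ 0 := by
  cases hu with
  | next_mesh _ k j hk hj h hs hp he => exact ⟨k, j, ⟨hk, hj, h, hs, hp⟩, he⟩

theorem Used.of_level_le {m : ℕ} (hu : D.Used lamAlg lamPic I m 0 0) :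
    ∀ i ≤ m, D.Used lamAlg lamPic I i 0 0 := by
  induction m with
  | zero => intro i hi; rwa [Nat.le_zero.1 hi]
  | succ m ih =>
    intro i hi
    rcases Nat.le_succ_iff.1 hi with h | rfl
    · obtain ⟨k, j, hf, -⟩ := hu.mesh_pred
      exact ih hf.used.level i h
    · exact hu

variable [DecidableEq E]

/-- A run of the adaptive algorithm under the standing assumptions, with admissible parameters. -/
structure IsAdmissibleRun (D : Setting 𝕜 V E) (I : Iterates V E)
    (Cstab Crel qred Cson Cmesh qalg lamAlgStar θ lamAlg lamPic Cmark : ℝ) : Prop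
    extends D.IsAdmissible Cstab Crel qred Cson Cmesh qalg lamAlgStar where
  param : AdmissibleParameters lamAlgStar (lamPicStar Cstab (qPic D.α D.L) qalg lamAlgStar)
    θ lamAlg lamPic
  run : D.IsRun lamAlg lamPic I θ Cmark

namespace IsAdmissibleRun

variable {Cstab Crel qred Cson Cmesh qalg lamAlgStar θ Cmark : ℝ}
  (h : D.IsAdmissibleRun I Cstab Crel qred Cson Cmesh qalg lamAlgStar θ lamAlg lamPic Cmark)

include h

theorem mem_X {ℓ k j : ℕ} (hu : D.Used lamAlg lamPic I ℓ k j) :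
    D.IsMesh (I.mesh ℓ) ∧ I.u ℓ k 0 ∈ D.X (I.mesh ℓ) ∧ I.u ℓ k j ∈ D.X (I.mesh ℓ) := by
  induction hu with
  | start =>
    rw [h.run.mesh_zero]
    exact ⟨Relation.ReflTransGen.refl, h.run.initial, h.run.initial⟩
  | first_picard ℓ hu ih =>
    rw [h.run.first_picard ℓ hu]
    exact ih
  | first_alg ℓ k hk hu ih =>
    refine ⟨ih.1, ih.2.1, ?_⟩
    rw [h.run.alg_step ℓ k 1 hk (.first_alg ℓ k hk hu)]
    exact h.alg.mem _ ih.1 _ _ ih.2.1 _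
  | next_alg ℓ k j hk hj hu hs ih =>
    refine ⟨ih.1, ih.2.1, ?_⟩
    rw [h.run.alg_step ℓ k (j + 1) hk (.next_alg ℓ k j hk hj hu hs)]
    exact h.alg.mem _ ih.1 _ _ ih.2.1 _
  | next_picard ℓ k j hk hj hu hs hp ih =>
    rw [h.run.next_picard ℓ k j hk hj hu hs hp]
    exact ⟨ih.1, ih.2.2, ih.2.2⟩
  | next_mesh ℓ k j hk hj hu hs hp he ih =>
    obtain ⟨hM, hT, hu0⟩ := h.run.next_mesh ℓ k j hk hj hu hs hp he
    have hr := refines_refine (D := D) hM.1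
    rw [hT, hu0]
    have := h.space.nested _ ih.1 _ hr ih.2.2
    exact ⟨ih.1.of_refines hr, this, this⟩

theorem algError_le_pow {ℓ k j : ℕ} (hk : 1 ≤ k) (hu : D.Used lamAlg lamPic I ℓ k j) :
    ‖D.uPicard I ℓ k - I.u ℓ k j‖ ≤ qalg ^ j * ‖D.uPicard I ℓ k - I.u ℓ k 0‖ := by
  obtain ⟨hT, h0, -⟩ := h.mem_X hu
  rw [uPicard, if_neg (by omega)]
  rw [h.run.alg_step ℓ k j hk hu]
  generalize D.picardRhs (I.u ℓ k 0) = G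
  clear hu
  induction j with
  | zero => rw [h.alg.zero _ hT _ _ h0, pow_zero, one_mul]
  | succ j ih =>
    refine (h.alg.contraction _ hT G _ h0 j).trans ?_
    rw [pow_succ', mul_assoc]
    exact mul_le_mul_of_nonneg_left ih h.const.alg_pos.le

/-- A posteriori bound for the algebraic error. -/
theorem algError_le_increment {ℓ k j : ℕ} (hk : 1 ≤ k) (hj : 1 ≤ j)
    (hu : D.Used lamAlg lamPic I ℓ k j) :
    ‖D.uPicard I ℓ k - I.u ℓ k j‖ ≤
      qalg / (1 - qalg) * ‖I.u ℓ k j - I.u ℓ k (j - 1)‖ := by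
  obtain ⟨i, rfl⟩ := Nat.exists_eq_add_of_le' hj
  obtain ⟨hT, h0, -⟩ := h.mem_X hu
  have h1 := h.alg.contraction _ hT (D.picardRhs (I.u ℓ k 0)) _ h0 i
  rw [← h.run.alg_step ℓ k _ hk hu, ← h.run.alg_step ℓ k _ hk hu.prev] at h1
  rw [uPicard, if_neg (by omega), Nat.add_sub_cancel]
  have h2 := norm_sub_le_norm_sub_add_norm_sub
    (D.linSol (I.mesh ℓ) (D.picardRhs (I.u ℓ k 0))) (I.u ℓ k (i + 1)) (I.u ℓ k i)
  have hq := sub_pos.2 h.const.alg_lt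
  have h3 := mul_le_mul_of_nonneg_left h2 h.const.alg_pos.le
  rw [div_mul_eq_mul_div, le_div_iff₀ hq]
  linarith

theorem algError_le_of_algStop {ℓ k j : ℕ} (hk : 1 ≤ k) (hj : 1 ≤ j)
    (hu : D.Used lamAlg lamPic I ℓ k j) (hs : D.AlgStop lamAlg I ℓ k j) :
    ‖D.uPicard I ℓ k - I.u ℓ k j‖ ≤ qalg / (1 - qalg) *
      (lamAlg * (D.eta (I.mesh ℓ) (I.u ℓ k j) + ‖I.u ℓ k j - I.u ℓ k 0‖)) :=
  (h.algError_le_increment hk hj hu).trans (mul_le_mul_of_nonneg_left hs h.const.Calg_pos.le)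

variable [CompleteSpace V]

theorem picard_contract {ℓ k j : ℕ} (hk : 1 ≤ k) (hu : D.Used lamAlg lamPic I ℓ k j) :
    ‖D.uStarOn (I.mesh ℓ) - D.uPicard I ℓ k‖ ≤
      qPic D.α D.L * ‖D.uStarOn (I.mesh ℓ) - I.u ℓ k 0‖ := by
  rw [uPicard, if_neg (by omega)]
  exact h.norm_uStarOn_sub_linSol_le (h.mem_X hu).1 _

/-! ### Linearization on a fixed level -/

theorem norm_sub_le_of_isFinal {ℓ k j : ℕ} (hf : D.IsFinal lamAlg lamPic I ℓ k j) :
    ‖D.uStarOn (I.mesh ℓ) - I.u ℓ k j‖ ≤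
      finalConst (qPic D.α D.L) qalg lamAlg lamPic * D.eta (I.mesh ℓ) (I.u ℓ k j) := by
  have h1 := h.picard_contract hf.one_le_k hf.used
  have h2 := h.algError_le_of_algStop hf.one_le_k hf.one_le_j hf.used hf.algStop
  have h3 : ‖I.u ℓ k j - I.u ℓ k 0‖ ≤ lamPic * D.eta (I.mesh ℓ) (I.u ℓ k j) := hf.picStop
  have hq0 := qPic_nonneg D.α D.L
  have hq1 := sub_pos.2 h.const.qPic_lt
  have hc := h.const.Calg_pos
  have t1 := norm_sub_le_norm_sub_add_norm_sub (D.uStarOn (I.mesh ℓ)) (D.uPicard I ℓ k)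
    (I.u ℓ k j)
  have t2 := norm_sub_le_norm_sub_add_norm_sub (D.uStarOn (I.mesh ℓ)) (D.uPicard I ℓ k)
    (I.u ℓ k 0)
  have t3 := norm_sub_le_norm_sub_add_norm_sub (D.uPicard I ℓ k) (I.u ℓ k j) (I.u ℓ k 0)
  have hla := h.param.alg_pos
  unfold finalConst
  set q := qPic D.α D.L
  set c := qalg / (1 - qalg)
  set x := ‖D.uStarOn (I.mesh ℓ) - D.uPicard I ℓ k‖
  set y := ‖D.uPicard I ℓ k - I.u ℓ k j‖
  set z := ‖I.u ℓ k j - I.u ℓ k 0‖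
  set e := D.eta (I.mesh ℓ) (I.u ℓ k j)
  have h4 : x ≤ q / (1 - q) * (y + z) := by
    rw [div_mul_eq_mul_div, le_div_iff₀ hq1]
    nlinarith
  have h5 : y ≤ c * lamAlg * (1 + lamPic) * e := by
    have := mul_le_mul_of_nonneg_left h3 (mul_pos hc hla).le
    linarith
  have hC : 0 ≤ q / (1 - q) := div_nonneg hq0 hq1.le
  have h6 := mul_le_mul_of_nonneg_left (add_le_add h5 h3) hC
  linarith

/-- All linearization steps except the last one on a level contract by the factor `q_Pic'`. -/
theorem norm_sub_le_of_not_picStop {ℓ k j : ℕ} (hk : 1 ≤ k) (hj : 1 ≤ j)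
    (hu : D.Used lamAlg lamPic I ℓ k j) (hs : D.AlgStop lamAlg I ℓ k j)
    (hn : ¬ D.PicStop lamPic I ℓ k j) :
    ‖D.uStarOn (I.mesh ℓ) - I.u ℓ k j‖ ≤ qPicPert (qPic D.α D.L) qalg lamAlgStar *
      ‖D.uStarOn (I.mesh ℓ) - I.u ℓ k 0‖ := by
  have h1 := h.picard_contract hk hu
  have h2 := h.algError_le_of_algStop hk hj hu hs
  have h3 : lamPic * D.eta (I.mesh ℓ) (I.u ℓ k j) < ‖I.u ℓ k j - I.u ℓ k 0‖ := not_le.1 hn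
  have hc := h.const.Calg_pos
  have hla := h.param.alg_pos
  have hlp := h.param.pic_pos
  have hsm := h.param.alg_small
  have t1 := norm_sub_le_norm_sub_add_norm_sub (D.uStarOn (I.mesh ℓ)) (D.uPicard I ℓ k)
    (I.u ℓ k j)
  have t2 := norm_sub_le_norm_sub_add_norm_sub (I.u ℓ k j) (D.uStarOn (I.mesh ℓ)) (I.u ℓ k 0)
  rw [norm_sub_rev (I.u ℓ k j) (D.uStarOn (I.mesh ℓ))] at t2
  unfold qPicPert
  rw [div_mul_eq_mul_div, le_div_iff₀ h.const.qPicPert_denom_pos]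
  set c := qalg / (1 - qalg)
  set z := ‖I.u ℓ k j - I.u ℓ k 0‖
  set e := D.eta (I.mesh ℓ) (I.u ℓ k j)
  have hz : 0 ≤ z := norm_nonneg _
  have h4 : e ≤ z / lamPic := by
    rw [le_div_iff₀ hlp]
    linarith
  have h5 : lamAlg * (e + z) ≤ lamAlgStar * z := by
    have h6 := mul_le_mul_of_nonneg_right hsm.le hz
    have h7 := mul_le_mul_of_nonneg_left h4 hla.le
    have h8 : (lamAlg + lamAlg / lamPic) * z = lamAlg * z + lamAlg * (z / lamPic) := by ring
    linarith
  have h9 := h2.trans (mul_le_mul_of_nonneg_left h5 hc.le)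
  have h10 := mul_le_mul_of_nonneg_left t2 (mul_pos hc h.const.star_pos).le
  linarith

theorem norm_sub_initial_le {ℓ k : ℕ} (hu : D.Used lamAlg lamPic I ℓ (k + 1) 0) :
    ‖D.uStarOn (I.mesh ℓ) - I.u ℓ (k + 1) 0‖ ≤ qPicPert (qPic D.α D.L) qalg lamAlgStar ^ k *
      ‖D.uStarOn (I.mesh ℓ) - I.u ℓ 0 0‖ := by
  induction k with
  | zero => rw [h.run.first_picard ℓ hu.level, pow_zero, one_mul]
  | succ k ih =>
    obtain ⟨j, hj, hu', hs, hn⟩ := hu.picard_pred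
    rw [h.run.next_picard ℓ (k + 1) j (by omega) hj hu' hs hn, pow_succ', mul_assoc]
    exact (h.norm_sub_le_of_not_picStop (by omega) hj hu' hs hn).trans
      (mul_le_mul_of_nonneg_left (ih hu'.first) h.const.pert_pos.le)

omit [CompleteSpace V] in
/-- The algebraic solver loop terminates: otherwise its iterates would converge to the initial
guess, which then solves the linear system, so that the loop stops at `j = 1`. -/
theorem exists_algStop {ℓ k : ℕ} (hk : 1 ≤ k) (hu : D.Used lamAlg lamPic I ℓ k 0) :
    ∃ j, 1 ≤ j ∧ D.Used lamAlg lamPic I ℓ k j ∧ D.AlgStop lamAlg I ℓ k j := by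
  by_contra! hcon
  have hall : ∀ j, D.Used lamAlg lamPic I ℓ k (j + 1) := fun j => by
    induction j with
    | zero => exact .first_alg ℓ k hk hu
    | succ j ih => exact .next_alg ℓ k (j + 1) hk (by omega) ih (hcon _ (by omega) ih)
  have hla := h.param.alg_pos
  have hq0 := h.const.alg_pos
  have hq1 := h.const.alg_lt
  set e := ‖D.uPicard I ℓ k - I.u ℓ k 0‖ with he
  have hstep : ∀ j, lamAlg * ‖I.u ℓ k (j + 1) - I.u ℓ k 0‖ < 2 * (qalg ^ j * e) := fun j => by
    have h1 := not_le.1 (hcon (j + 1) (by omega) (hall j))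
    rw [Nat.add_sub_cancel] at h1
    have h2 := h.algError_le_pow hk (hall j)
    have h3 := h.algError_le_pow hk (hall j).prev
    have h4 := norm_sub_le_norm_sub_add_norm_sub (I.u ℓ k (j + 1)) (D.uPicard I ℓ k) (I.u ℓ k j)
    rw [norm_sub_rev (I.u ℓ k (j + 1)) (D.uPicard I ℓ k)] at h4
    have h5 : qalg ^ (j + 1) * e ≤ qalg ^ j * e :=
      mul_le_mul_of_nonneg_right (pow_le_pow_of_le_one hq0.le hq1.le (by omega)) (norm_nonneg _)
    have h6 := mul_nonneg hla.le (eta_nonneg (D := D) (I.mesh ℓ) (I.u ℓ k (j + 1)))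
    linarith
  have he0 : 0 < e := by
    have h1 := hstep 0
    have h2 := mul_nonneg hla.le (norm_nonneg (I.u ℓ k (0 + 1) - I.u ℓ k 0))
    rw [pow_zero, one_mul] at h1
    linarith
  obtain ⟨n, hn⟩ := exists_pow_lt_of_lt_one
    (show 0 < lamAlg / (lamAlg + 2) by positivity) hq1
  rw [lt_div_iff₀ (by positivity)] at hn
  have h1 := hstep n
  have h2 := h.algError_le_pow hk (hall n)
  have h3 := norm_sub_le_norm_sub_add_norm_sub (D.uPicard I ℓ k) (I.u ℓ k (n + 1)) (I.u ℓ k 0)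
  have h4 : qalg ^ (n + 1) * e ≤ qalg ^ n * e :=
    mul_le_mul_of_nonneg_right (pow_le_pow_of_le_one hq0.le hq1.le (by omega)) (norm_nonneg _)
  have h5 := mul_le_mul_of_nonneg_left (h3.trans (add_le_add_left (h2.trans h4) _)) hla.le
  have h6 := mul_lt_mul_of_pos_right hn he0
  linarith

/-- On the last level the discrete solution is exact: either the final iterate has vanishing
estimator, or the linearization does not terminate and its limit has vanishing estimator. -/
theorem eta_uStarOn_eq_zero {ℓ : ℕ} (hu : D.Used lamAlg lamPic I ℓ 0 0)
    (hn : ¬ D.Used lamAlg lamPic I (ℓ + 1) 0 0) :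
    D.eta (I.mesh ℓ) (D.uStarOn (I.mesh ℓ)) = 0 := by
  have hT := (h.mem_X hu).1
  have hstar := (h.uStarOn_spec hT).1
  by_cases hf : ∃ k j, D.IsFinal lamAlg lamPic I ℓ k j
  · obtain ⟨k, j, hf⟩ := hf
    have h0 : D.eta (I.mesh ℓ) (I.u ℓ k j) = 0 := by
      by_contra h0
      exact hn (.next_mesh ℓ k j hf.one_le_k hf.one_le_j hf.used hf.algStop hf.picStop h0)
    have h1 := h.norm_sub_le_of_isFinal hf
    rw [h0, mul_zero, norm_le_zero_iff, sub_eq_zero] at h1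
    rw [h1, h0]
  · have hall : ∀ k, D.Used lamAlg lamPic I ℓ (k + 1) 0 := fun k => by
      induction k with
      | zero => exact .first_picard ℓ hu
      | succ k ih =>
        obtain ⟨j, hj, hu', hs⟩ := h.exists_algStop (by omega) ih
        exact .next_picard ℓ (k + 1) j (by omega) hj hu' hs
          fun hp => hf ⟨k + 1, j, by omega, hj, hu', hs, hp⟩
    have hq0 := h.const.pert_pos
    have hq1 := h.const.pert_lt
    have hlp := h.param.pic_pos
    have hCs := h.const.stab_pos
    set q := qPicPert (qPic D.α D.L) qalg lamAlgStar
    set e := ‖D.uStarOn (I.mesh ℓ) - I.u ℓ 0 0‖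
    have hstep : ∀ k, D.eta (I.mesh ℓ) (D.uStarOn (I.mesh ℓ)) ≤
        q ^ k * ((2 / lamPic + Cstab) * e) := fun k => by
      obtain ⟨j, hj, hu', hs, hn⟩ := (hall (k + 1)).picard_pred
      have h1 := h.norm_sub_initial_le (hall k)
      have h2 := h.norm_sub_initial_le (hall (k + 1))
      rw [h.run.next_picard ℓ (k + 1) j (by omega) hj hu' hs hn] at h2
      have h3 := not_le.1 hn
      have h4 := norm_sub_le_norm_sub_add_norm_sub (I.u ℓ (k + 1) j) (D.uStarOn (I.mesh ℓ))
        (I.u ℓ (k + 1) 0)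
      rw [norm_sub_rev (I.u ℓ (k + 1) j) (D.uStarOn (I.mesh ℓ))] at h4
      have h5 : q ^ (k + 1) * e ≤ q ^ k * e :=
        mul_le_mul_of_nonneg_right (pow_le_pow_of_le_one hq0.le hq1.le (by omega))
          (norm_nonneg _)
      have h6 : D.eta (I.mesh ℓ) (I.u ℓ (k + 1) j) ≤ 2 / lamPic * (q ^ k * e) := by
        rw [div_mul_eq_mul_div, le_div_iff₀ hlp]
        linarith
      have h7 := h.eta_le_add hT hstar (h.mem_X hu').2.2
      have h8 := mul_le_mul_of_nonneg_left (h2.trans h5) hCs.le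
      linarith
    refine le_antisymm (ge_of_tendsto' (x := atTop) ?_ hstep) (eta_nonneg _ _)
    simpa using (tendsto_pow_atTop_nhds_zero_of_lt_one hq0.le hq1).mul_const
      ((2 / lamPic + Cstab) * e)

end IsAdmissibleRun

end Setting

/-! ### Quasi-errors on consecutive levels -/

/-- Stability constant of the quasi-error on a level, with `r = L / α`. -/
noncomputable def levelConst (r Cstab : ℝ) : ℝ := 1 + r + (5 + 4 * Cstab) * (1 + r)

/-- The initial quasi-error on a level is at most this multiple of the estimator of the exact
discrete solution on the previous level. -/
noncomputable def transferConst (Cstab Crel K : ℝ) : ℝ := Crel + (1 + K) / (1 - Cstab * K)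

namespace Setting.IsAdmissibleRun

variable {𝕜 V E : Type*} [RCLike 𝕜] [NormedAddCommGroup V] [InnerProductSpace 𝕜 V]
  {D : Setting 𝕜 V E} {I : Iterates V E} [DecidableEq E] [CompleteSpace V]
  {Cstab Crel qred Cson Cmesh qalg lamAlgStar θ lamAlg lamPic Cmark : ℝ}
  (h : D.IsAdmissibleRun I Cstab Crel qred Cson Cmesh qalg lamAlgStar θ lamAlg lamPic Cmark)

include h

theorem quasiError_le_initial {ℓ k j : ℕ} (hu : D.Used lamAlg lamPic I ℓ k j) :
    D.quasiError I ℓ k j ≤ levelConst (D.L / D.α) Cstab * D.quasiError I ℓ 0 0 := by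
  have hα := h.const.alpha_pos
  have hL : 0 < D.L := hα.trans_le h.const.alpha_le
  have hCs := h.const.stab_pos
  have hr : 0 < D.L / D.α := div_pos hL hα
  have hq0 : D.quasiError I ℓ 0 0 =
      ‖D.uStar - I.u ℓ 0 0‖ + D.eta (I.mesh ℓ) (I.u ℓ 0 0) := by
    simp [quasiError, uPicard]
  have he := eta_nonneg (D := D) (I.mesh ℓ) (I.u ℓ 0 0)
  rcases Nat.eq_zero_or_pos k with rfl | hk
  · obtain rfl := hu.j_eq_zero rfl
    refine le_mul_of_one_le_left ?_ ?_
    · rw [hq0]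
      positivity
    · unfold levelConst
      have : 0 < (5 + 4 * Cstab) * (1 + D.L / D.α) := by positivity
      linarith
  · obtain ⟨i, rfl⟩ := Nat.exists_eq_add_of_le' hk
    obtain ⟨hT, -, hX⟩ := h.mem_X hu
    have hX0 := (h.mem_X hu.level).2.1
    have h1 := h.norm_uStar_sub_uStarOn_le hT hX0
    have h2 := h.norm_sub_initial_le hu.first
    have h3 : ‖D.uStarOn (I.mesh ℓ) - I.u ℓ (i + 1) 0‖ ≤ ‖D.uStarOn (I.mesh ℓ) - I.u ℓ 0 0‖ :=
      h2.trans (mul_le_of_le_one_left (norm_nonneg _)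
        (pow_le_one₀ h.const.pert_pos.le h.const.pert_lt.le))
    have h4 := (h.picard_contract hk hu).trans
      (mul_le_of_le_one_left (norm_nonneg _) h.const.qPic_lt.le)
    have h5 := (h.algError_le_pow hk hu).trans
      (mul_le_of_le_one_left (norm_nonneg _) (pow_le_one₀ h.const.alg_pos.le h.const.alg_lt.le))
    have t1 := norm_sub_le_norm_sub_add_norm_sub (D.uPicard I ℓ (i + 1)) (D.uStarOn (I.mesh ℓ))
      (I.u ℓ (i + 1) 0)
    rw [norm_sub_rev (D.uPicard I ℓ (i + 1)) (D.uStarOn (I.mesh ℓ))] at t1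
    have t2 := norm_sub_le_norm_sub_add_norm_sub (D.uStarOn (I.mesh ℓ)) (D.uPicard I ℓ (i + 1))
      (I.u ℓ (i + 1) j)
    have t3 := norm_sub_le_norm_sub_add_norm_sub D.uStar (D.uStarOn (I.mesh ℓ))
      (I.u ℓ (i + 1) j)
    have t4 := norm_sub_le_norm_sub_add_norm_sub (I.u ℓ (i + 1) j) (D.uStarOn (I.mesh ℓ))
      (I.u ℓ 0 0)
    rw [norm_sub_rev (I.u ℓ (i + 1) j) (D.uStarOn (I.mesh ℓ))] at t4
    have t5 := norm_sub_le_norm_sub_add_norm_sub (D.uStarOn (I.mesh ℓ)) D.uStar (I.u ℓ 0 0)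
    rw [norm_sub_rev (D.uStarOn (I.mesh ℓ)) D.uStar] at t5
    have h6 := h.eta_le_add hT hX hX0
    rw [hq0]
    unfold quasiError levelConst
    set r := D.L / D.α
    set e := ‖D.uStarOn (I.mesh ℓ) - I.u ℓ 0 0‖
    set x := ‖D.uStar - I.u ℓ 0 0‖
    have hx : 0 ≤ x := norm_nonneg _
    have hE : e ≤ (1 + r) * x := by linarith
    have h7 : ‖I.u ℓ (i + 1) j - I.u ℓ 0 0‖ ≤ 4 * e := by linarith
    have h8 := mul_le_mul_of_nonneg_left h7 hCs.le
    have h9 := mul_le_mul_of_nonneg_left hE (show 0 ≤ 5 + 4 * Cstab by linarith)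
    have h10 : 0 ≤ (r + (5 + 4 * Cstab) * (1 + r)) * D.eta (I.mesh ℓ) (I.u ℓ 0 0) := by
      positivity
    linarith

/-- Everything a completed level provides: the mesh is strictly refined, the exact discrete
solution satisfies the Dörfler criterion on the refined elements, and every set that satisfies it
with the parameter `θ'` bounds the number of marked elements. -/
theorem level_step {ℓ : ℕ} (hu : D.Used lamAlg lamPic I (ℓ + 1) 0 0) :
    I.marked ℓ ⊆ I.mesh ℓ ∧ I.mesh (ℓ + 1) = D.refine (I.mesh ℓ) (I.marked ℓ) ∧
    (I.mesh ℓ).card < (I.mesh (ℓ + 1)).card ∧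
    0 < D.eta (I.mesh ℓ) (D.uStarOn (I.mesh ℓ)) ∧
    exactTheta Cstab (finalConst (qPic D.α D.L) qalg lamAlg lamPic) θ *
      D.eta (I.mesh ℓ) (D.uStarOn (I.mesh ℓ)) ≤
        D.etaOn (I.mesh ℓ) (I.mesh ℓ \ I.mesh (ℓ + 1)) (D.uStarOn (I.mesh ℓ)) ∧
    (∀ R ⊆ I.mesh ℓ, thetaPrime Cstab (qPic D.α D.L) qalg lamAlgStar θ lamAlg lamPic *
      D.eta (I.mesh ℓ) (D.uStarOn (I.mesh ℓ)) ≤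
        D.etaOn (I.mesh ℓ) R (D.uStarOn (I.mesh ℓ)) →
      ((I.marked ℓ).card : ℝ) ≤ Cmark * R.card) ∧
    D.quasiError I (ℓ + 1) 0 0 ≤
      transferConst Cstab Crel (finalConst (qPic D.α D.L) qalg lamAlg lamPic) *
        D.eta (I.mesh ℓ) (D.uStarOn (I.mesh ℓ)) := by
  obtain ⟨k, j, hf, he⟩ := hu.mesh_pred
  obtain ⟨⟨hMT, hmark, hmin⟩, hT', hu0⟩ := h.run.next_mesh ℓ k j hf.one_le_k hf.one_le_j hf.used
    hf.algStop hf.picStop he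
  obtain ⟨hT, -, hX⟩ := h.mem_X hf.used
  have hR := refines_refine (D := D) hMT
  have hstar := (h.uStarOn_spec hT).1
  have hbound := h.norm_sub_le_of_isFinal hf
  have hK := finalConst_pos h.const h.param
  have hKθ := stab_mul_finalConst_lt h.const h.param
  have hKl := stab_mul_finalConst_le h.const h.param
  have hlθ := div_lamPicStar_lt h.const h.param
  have hθ := h.param.theta_pos
  have hθ1 := h.param.theta_le
  have hCs := h.const.stab_pos
  have htp := thetaPrime_pos h.const h.param
  have htpe := thetaPrime_eq Cstab (qPic D.α D.L) qalg lamAlgStar θ lamAlg lamPic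
  rw [eq_div_iff (by linarith)] at htpe
  set K := finalConst (qPic D.α D.L) qalg lamAlg lamPic
  set t := thetaPrime Cstab (qPic D.α D.L) qalg lamAlgStar θ lamAlg lamPic
  set l := lamPic / lamPicStar Cstab (qPic D.α D.L) qalg lamAlgStar
  set T := I.mesh ℓ
  set x := I.u ℓ k j
  set us := D.uStarOn T
  have hK' : 0 < Cstab * K := mul_pos hCs hK
  have he0 : 0 < D.eta T x := lt_of_le_of_ne (eta_nonneg _ _) (Ne.symm he)
  have hb : Cstab * ‖us - x‖ ≤ Cstab * K * D.eta T x := by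
    rw [mul_assoc]
    exact mul_le_mul_of_nonneg_left hbound hCs.le
  have hb' : Cstab * ‖x - us‖ ≤ Cstab * K * D.eta T x := by rwa [norm_sub_rev]
  have hlow : (1 - Cstab * K) * D.eta T x ≤ D.eta T us := by
    have := h.eta_le_add hT hX hstar
    linarith
  have hup : D.eta T us ≤ (1 + Cstab * K) * D.eta T x := by
    have := h.eta_le_add hT hstar hX
    linarith
  have hMne : (I.marked ℓ).Nonempty := by
    rw [Finset.nonempty_iff_ne_empty]
    intro h0
    rw [h0] at hmark
    have : D.etaOn T ∅ x = 0 := by simp [etaOn]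
    rw [this] at hmark
    nlinarith
  have hsub := h.mesh.marked_subset T hT _ hMT
  refine ⟨hMT, hT', ?_, ?_, ?_, ?_, ?_⟩
  · rw [hT']
    have h1 := h.mesh.card_le_card T hT _ hMT
    have h2 := Finset.card_le_card hsub
    have h3 := hMne.card_pos
    omega
  · exact lt_of_lt_of_le (mul_pos (by linarith) he0) hlow
  · rw [hT']
    have h1 := etaOn_mono (D := D) T hsub us
    have h2 := h.etaOn_le_add hT hX hstar hMT
    have h3 : exactTheta Cstab K θ * D.eta T us ≤ (θ - Cstab * K) * D.eta T x := by
      unfold exactTheta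
      rw [div_mul_eq_mul_div, div_le_iff₀ (by linarith)]
      have := mul_le_mul_of_nonneg_left hup (sub_nonneg.2 hKθ.le)
      linarith
    linarith
  · intro R hRT hRd
    refine hmin R hRT ?_
    have h1 := h.etaOn_le_add hT hstar hX hRT
    have h2 := mul_le_mul_of_nonneg_left hlow htp.le
    have h3 : t * (1 - l) * D.eta T x ≤ t * (1 - Cstab * K) * D.eta T x :=
      mul_le_mul_of_nonneg_right (mul_le_mul_of_nonneg_left (by linarith) htp.le) he0.le
    rw [htpe] at h3
    linarith
  · have h1 := h.est.reliability T hT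
    have h2 := h.eta_refines_le hT hR hX
    have h3 := norm_sub_le_norm_sub_add_norm_sub D.uStar us x
    have h4 : (1 + K) * D.eta T x ≤ (1 + K) / (1 - Cstab * K) * D.eta T us := by
      rw [div_mul_eq_mul_div, le_div_iff₀ (by linarith)]
      have := mul_le_mul_of_nonneg_left hlow (show 0 ≤ 1 + K by linarith)
      linarith
    have h5 : D.quasiError I (ℓ + 1) 0 0 = ‖D.uStar - x‖ + D.eta (D.refine T (I.marked ℓ)) x := by
      simp [quasiError, uPicard, hu0, hT', x, T]
    rw [h5]
    unfold transferConst
    linarith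

end Setting.IsAdmissibleRun

/-! ### Lower bound for the weighted quasi-errors -/

/-- The exact discrete solution is quasi-optimal with respect to error plus estimator, with
`r = L / α`. -/
noncomputable def galerkinConst (r Cstab : ℝ) : ℝ := 1 + r + Cstab * (1 + r)

/-- The constant `c_opt`; the truncation at `1` makes it positive for all arguments. -/
noncomputable def lowerConst (s r Cstab Cson : ℝ) (n : ℕ) : ℝ :=
  max 1 ((Cson * n) ^ s * galerkinConst r Cstab)

theorem lowerConst_pos (s r Cstab Cson : ℝ) (n : ℕ) : 0 < lowerConst s r Cstab Cson n :=
  zero_lt_one.trans_le (le_max_left _ _)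

namespace Setting

variable {𝕜 V E : Type*} [RCLike 𝕜] [NormedAddCommGroup V] [InnerProductSpace 𝕜 V]
  {D : Setting 𝕜 V E} {I : Iterates V E}

theorem quasiError_nonneg (ℓ k j : ℕ) : 0 ≤ D.quasiError I ℓ k j := by
  have := eta_nonneg (D := D) (I.mesh ℓ) (I.u ℓ k j)
  unfold quasiError
  positivity

namespace IsAdmissibleRun

variable [DecidableEq E] [CompleteSpace V]
  {Cstab Crel qred Cson Cmesh qalg lamAlgStar θ lamAlg lamPic Cmark : ℝ}
  (h : D.IsAdmissibleRun I Cstab Crel qred Cson Cmesh qalg lamAlgStar θ lamAlg lamPic Cmark)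

include h

theorem galerkin_le_quasiError {ℓ : ℕ} (hu : D.Used lamAlg lamPic I ℓ 0 0) :
    ‖D.uStar - D.uStarOn (I.mesh ℓ)‖ + D.eta (I.mesh ℓ) (D.uStarOn (I.mesh ℓ)) ≤
      galerkinConst (D.L / D.α) Cstab * D.quasiError I ℓ 0 0 := by
  obtain ⟨hT, -, hX⟩ := h.mem_X hu
  have h1 := h.norm_uStar_sub_uStarOn_le hT hX
  have h2 := h.eta_le_add hT (h.uStarOn_spec hT).1 hX
  have h3 := norm_sub_le_norm_sub_add_norm_sub (D.uStarOn (I.mesh ℓ)) D.uStar (I.u ℓ 0 0)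
  rw [norm_sub_rev (D.uStarOn (I.mesh ℓ)) D.uStar] at h3
  have hCs := h.const.stab_pos
  have hr : 0 < D.L / D.α :=
    div_pos (h.const.alpha_pos.trans_le h.const.alpha_le) h.const.alpha_pos
  have he := eta_nonneg (D := D) (I.mesh ℓ) (I.u ℓ 0 0)
  have hq0 : D.quasiError I ℓ 0 0 =
      ‖D.uStar - I.u ℓ 0 0‖ + D.eta (I.mesh ℓ) (I.u ℓ 0 0) := by
    simp [quasiError, uPicard]
  rw [hq0]
  unfold galerkinConst
  set r := D.L / D.α
  have h4 : ‖D.uStarOn (I.mesh ℓ) - I.u ℓ 0 0‖ ≤ (1 + r) * ‖D.uStar - I.u ℓ 0 0‖ := by linarith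
  have h5 := mul_le_mul_of_nonneg_left h4 hCs.le
  have h6 : 0 ≤ (r + Cstab * (1 + r)) * D.eta (I.mesh ℓ) (I.u ℓ 0 0) := by positivity
  have h7 := norm_nonneg (D.uStar - I.u ℓ 0 0)
  linarith

theorem add_le_card_mesh {ℓ : ℕ} (hu : D.Used lamAlg lamPic I ℓ 0 0) :
    D.T₀.card + ℓ ≤ (I.mesh ℓ).card := by
  induction ℓ with
  | zero => rw [h.run.mesh_zero, add_zero]
  | succ ℓ ih =>
    have h1 := ih (hu.of_level_le ℓ (Nat.le_succ ℓ))
    have h2 := (h.level_step hu).2.2.1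
    omega

omit [CompleteSpace V] in
/-- One refinement step multiplies the number of elements at most by `Cson`. -/
theorem card_refine_le {T M : Finset E} (hT : D.IsMesh T) (hM : M ⊆ T) :
    ((D.refine T M).card : ℝ) ≤ Cson * T.card := by
  have h1 := h.mesh.card_le_son T hT M hM
  have h2 : ((T \ D.refine T M).card : ℝ) + (T ∩ D.refine T M).card = T.card := by
    exact_mod_cast Finset.card_sdiff_add_card_inter T (D.refine T M)
  have h3 : ((T ∩ D.refine T M).card : ℝ) ≤ Cson * (T ∩ D.refine T M).card :=
    le_mul_of_one_le_left (Nat.cast_nonneg _) (by linarith [h.const.son_ge])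
  rw [← h2]
  linarith

/-- For every `N`, the finest mesh of the run with at most `N` additional elements is almost
optimal: the next mesh has more than `N` additional elements, but at most `Cson` times as many
elements; and on the last mesh the discrete solution is exact. -/
theorem approxNorm_le {s : ℝ} (hs : 0 < s) :
    D.approxNorm s ≤ ENNReal.ofReal (lowerConst s (D.L / D.α) Cstab Cson D.T₀.card) *
      ⨆ (ℓ : ℕ) (k : ℕ) (j : ℕ) (_ : D.Used lamAlg lamPic I ℓ k j), D.weightedError I s ℓ k j := by
  refine iSup_le fun N => ?_
  obtain ⟨ℓ, ⟨hu, hcard⟩, hnext⟩ : ∃ ℓ,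
      (D.Used lamAlg lamPic I ℓ 0 0 ∧ (I.mesh ℓ).card ≤ N + D.T₀.card) ∧
      ¬ (D.Used lamAlg lamPic I (ℓ + 1) 0 0 ∧ (I.mesh (ℓ + 1)).card ≤ N + D.T₀.card) := by
    by_contra! hcon
    have hall : ∀ ℓ, D.Used lamAlg lamPic I ℓ 0 0 ∧ (I.mesh ℓ).card ≤ N + D.T₀.card := fun ℓ => by
      induction ℓ with
      | zero => exact ⟨.start, by rw [h.run.mesh_zero]; omega⟩
      | succ ℓ ih => exact hcon ℓ ih
    have h1 := h.add_le_card_mesh (hall (N + 1)).1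
    have h2 := (hall (N + 1)).2
    omega
  have hT := (h.mem_X hu).1
  have hinf : (⨅ (T : Finset E) (_ : D.IsMesh T ∧ (T.card : ℝ) - D.T₀.card ≤ N),
      ENNReal.ofReal (‖D.uStar - D.uStarOn T‖ + D.eta T (D.uStarOn T))) ≤
      ENNReal.ofReal (‖D.uStar - D.uStarOn (I.mesh ℓ)‖ +
        D.eta (I.mesh ℓ) (D.uStarOn (I.mesh ℓ))) := by
    refine iInf₂_le (I.mesh ℓ) ⟨hT, ?_⟩
    have : ((I.mesh ℓ).card : ℝ) ≤ ((N + D.T₀.card : ℕ) : ℝ) := by exact_mod_cast hcard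
    push_cast at this
    linarith
  refine (mul_le_mul_right hinf _).trans ?_
  by_cases hu' : D.Used lamAlg lamPic I (ℓ + 1) 0 0
  · have hlt : N + D.T₀.card < (I.mesh (ℓ + 1)).card := by
      by_contra! hc
      exact hnext ⟨hu', hc⟩
    have hn0 : 1 ≤ D.T₀.card := h.mesh.nonempty.card_pos
    have hn : (1 : ℝ) ≤ D.T₀.card := by exact_mod_cast hn0
    have hle0 : (D.T₀.card : ℝ) ≤ (I.mesh ℓ).card := by exact_mod_cast h.mesh.card_init_le hT
    have hCson := h.const.son_ge
    obtain ⟨hM, hT', -⟩ := h.level_step hu'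
    have hson := h.card_refine_le hT hM
    rw [← hT'] at hson
    set n : ℝ := (D.T₀.card : ℝ)
    set X : ℝ := ((I.mesh ℓ).card : ℝ)
    have hN : (N : ℝ) + 1 ≤ Cson * n * (X - n + 1) := by
      have h1 : (N : ℝ) + 1 ≤ (I.mesh (ℓ + 1)).card := by
        exact_mod_cast (by omega : N + 1 ≤ (I.mesh (ℓ + 1)).card)
      have h2 : X ≤ n * (X - n + 1) := by nlinarith
      have h3 := mul_le_mul_of_nonneg_left h2 (show 0 ≤ Cson by linarith)
      linarith
    have hpow : ((N : ℝ) + 1) ^ s ≤ (Cson * n) ^ s * (X - n + 1) ^ s := by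
      rw [← Real.mul_rpow (by positivity) (by linarith)]
      exact Real.rpow_le_rpow (by positivity) hN hs.le
    have hgal := h.galerkin_le_quasiError hu
    have hq := quasiError_nonneg (D := D) (I := I) ℓ 0 0
    have hX : 0 ≤ (X - n + 1) ^ s := Real.rpow_nonneg (by linarith) _
    have hsup : D.weightedError I s ℓ 0 0 ≤
        ⨆ (ℓ : ℕ) (k : ℕ) (j : ℕ) (_ : D.Used lamAlg lamPic I ℓ k j),
          D.weightedError I s ℓ k j :=
      le_iSup_of_le ℓ (le_iSup_of_le 0 (le_iSup₂_of_le 0 hu le_rfl))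
    refine le_trans ?_ (mul_le_mul_right hsup _)
    rw [weightedError, ← ENNReal.ofReal_mul (by positivity),
      ← ENNReal.ofReal_mul (lowerConst_pos _ _ _ _ _).le]
    refine ENNReal.ofReal_le_ofReal ?_
    calc _ ≤ (Cson * n) ^ s * (X - n + 1) ^ s *
          (galerkinConst (D.L / D.α) Cstab * D.quasiError I ℓ 0 0) :=
          mul_le_mul hpow hgal (add_nonneg (norm_nonneg _) (eta_nonneg _ _)) (by positivity)
      _ = (Cson * n) ^ s * galerkinConst (D.L / D.α) Cstab *
          ((X - n + 1) ^ s * D.quasiError I ℓ 0 0) := by ring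
      _ ≤ _ := mul_le_mul_of_nonneg_right (le_max_right _ _) (mul_nonneg hX hq)
  · have h0 := h.eta_uStarOn_eq_zero hu hu'
    have h1 := h.est.reliability _ hT
    rw [h0, mul_zero] at h1
    rw [h0, le_antisymm h1 (norm_nonneg _), add_zero, ENNReal.ofReal_zero, mul_zero]
    exact zero_le

end IsAdmissibleRun

end Setting

/-! ### Upper bound for the weighted quasi-errors -/

/-- A geometric series bound: if `a²` is equivalent to a linearly decreasing quantity `Q`, then the
sum of the `a i ^ (-1 / s)` is dominated by its last summand. -/
theorem sum_inv_rpow_le {a Q : ℕ → ℝ} {m : ℕ} {ρ k s : ℝ} (hρ : 0 < ρ) (hρ1 : ρ < 1) (hk : 0 < k)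
    (hs : 0 < s) (ha : ∀ i ≤ m, 0 < a i) (haQ : ∀ i ≤ m, a i ^ 2 ≤ Q i)
    (hQa : ∀ i ≤ m, Q i ≤ k * a i ^ 2) (hQ : ∀ i < m, Q (i + 1) ≤ ρ * Q i) :
    ∑ i ∈ Finset.range (m + 1), (a i)⁻¹ ^ s⁻¹ ≤
      k ^ (2 * s)⁻¹ / (1 - ρ ^ (2 * s)⁻¹) * (a m)⁻¹ ^ s⁻¹ := by
  set p := (2 * s)⁻¹ with hp
  have hp0 : 0 < p := by positivity
  have hr1 : ρ ^ p < 1 := Real.rpow_lt_one hρ.le hρ1 hp0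
  have hr0 : 0 < ρ ^ p := Real.rpow_pos_of_pos hρ p
  have hQ0 : ∀ i ≤ m, 0 < Q i := fun i hi =>
    lt_of_lt_of_le (pow_pos (ha i hi) 2) (haQ i hi)
  have hap : ∀ i ≤ m, (a i)⁻¹ ^ s⁻¹ = ((a i ^ 2)⁻¹) ^ p := fun i hi => by
    rw [← inv_pow, ← Real.rpow_natCast, ← Real.rpow_mul (inv_nonneg.2 (ha i hi).le)]
    congr 1
    rw [hp]
    push_cast
    field_simp
  have hsum : ∀ n ≤ m, ∑ i ∈ Finset.range (n + 1), (Q i)⁻¹ ^ p ≤ (Q n)⁻¹ ^ p / (1 - ρ ^ p) := by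
    intro n
    induction n with
    | zero =>
      intro _
      rw [zero_add, Finset.sum_range_one, le_div_iff₀ (by linarith)]
      have : 0 ≤ (Q 0)⁻¹ ^ p := Real.rpow_nonneg (inv_nonneg.2 (hQ0 0 (by omega)).le) _
      nlinarith
    | succ n ih =>
      intro hn
      have h0 := hQ0 n (by omega)
      have h1 := hQ0 (n + 1) hn
      have h2 : (Q n)⁻¹ ≤ ρ * (Q (n + 1))⁻¹ := by
        rw [inv_le_comm₀ h0 (by positivity), mul_inv, inv_inv, inv_mul_le_iff₀ hρ]
        exact hQ n (by omega)
      have h3 : (Q n)⁻¹ ^ p ≤ ρ ^ p * (Q (n + 1))⁻¹ ^ p := by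
        rw [← Real.mul_rpow hρ.le (inv_nonneg.2 h1.le)]
        exact Real.rpow_le_rpow (inv_nonneg.2 h0.le) h2 hp0.le
      rw [Finset.sum_range_succ]
      have h4 := ih (by omega)
      rw [le_div_iff₀ (by linarith)] at h4 ⊢
      rw [add_mul]
      linarith
  have hterm : ∀ i ∈ Finset.range (m + 1), (a i)⁻¹ ^ s⁻¹ ≤ k ^ p * (Q i)⁻¹ ^ p := fun i hi => by
    have hi' : i ≤ m := Nat.lt_succ_iff.1 (Finset.mem_range.1 hi)
    have h0 := ha i hi'
    rw [hap i hi', ← Real.mul_rpow hk.le (inv_nonneg.2 (hQ0 i hi').le)]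
    refine Real.rpow_le_rpow (by positivity) ?_ hp0.le
    rw [inv_le_comm₀ (by positivity) (mul_pos hk (inv_pos.2 (hQ0 i hi'))), mul_inv, inv_inv,
      inv_mul_le_iff₀ hk]
    exact hQa i hi'
  have hlast : (Q m)⁻¹ ^ p ≤ (a m)⁻¹ ^ s⁻¹ := by
    have h0 := ha m le_rfl
    rw [hap m le_rfl]
    exact Real.rpow_le_rpow (inv_nonneg.2 (hQ0 m le_rfl).le)
      (inv_anti₀ (by positivity) (haQ m le_rfl)) hp0.le
  calc _ ≤ ∑ i ∈ Finset.range (m + 1), k ^ p * (Q i)⁻¹ ^ p := Finset.sum_le_sum hterm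
    _ = k ^ p * ∑ i ∈ Finset.range (m + 1), (Q i)⁻¹ ^ p := by rw [Finset.mul_sum]
    _ ≤ k ^ p * ((Q m)⁻¹ ^ p / (1 - ρ ^ p)) :=
        mul_le_mul_of_nonneg_left (hsum m le_rfl) (Real.rpow_nonneg hk.le _)
    _ = k ^ p / (1 - ρ ^ p) * (Q m)⁻¹ ^ p := by ring
    _ ≤ _ := mul_le_mul_of_nonneg_left hlast
        (div_nonneg (Real.rpow_nonneg hk.le _) (by linarith))

/-- The constant of `sum_inv_rpow_le` for the Lyapunov functional with Dörfler parameter `t`. -/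
noncomputable def seriesConst (s α L Cstab Crel qred t : ℝ) : ℝ :=
  lyapRatio α L Cstab Crel qred t ^ (2 * s)⁻¹ /
    (1 - lyapRate α L Cstab Crel qred t ^ (2 * s)⁻¹)

/-- The constant of the upper bound on levels `ℓ ≥ 1`, where `K` is the constant of the final
iterates and `t` is the perturbed marking parameter `θ'`. -/
noncomputable def rateConst (s α L Cstab Crel qred Cmark Cmesh θ K t : ℝ) : ℝ :=
  (2 * Cmesh * Cmark * seriesConst s α L Cstab Crel qred (exactTheta Cstab K θ)) ^ s /
    (optFactor Cstab Crel t / (1 + Cstab * Crel)) *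
    (levelConst (L / α) Cstab * transferConst Cstab Crel K)

/-- The constant `C_opt`; the truncation at `1` makes it positive for all arguments. -/
noncomputable def upperConst
    (s α L Cstab Crel qred Cmark Cmesh qalg lamAlgStar θ lamAlg lamPic : ℝ) : ℝ :=
  max 1 (max (levelConst (L / α) Cstab)
    (rateConst s α L Cstab Crel qred Cmark Cmesh θ (finalConst (qPic α L) qalg lamAlg lamPic)
      (thetaPrime Cstab (qPic α L) qalg lamAlgStar θ lamAlg lamPic)))

theorem upperConst_pos (s α L Cstab Crel qred Cmark Cmesh qalg lamAlgStar θ lamAlg lamPic : ℝ) :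
    0 < upperConst s α L Cstab Crel qred Cmark Cmesh qalg lamAlgStar θ lamAlg lamPic :=
  zero_lt_one.trans_le (le_max_left _ _)

namespace Setting.IsAdmissibleRun

variable {𝕜 V E : Type*} [RCLike 𝕜] [NormedAddCommGroup V] [InnerProductSpace 𝕜 V]
  {D : Setting 𝕜 V E} {I : Iterates V E} [DecidableEq E] [CompleteSpace V]
  {Cstab Crel qred Cson Cmesh qalg lamAlgStar θ lamAlg lamPic Cmark : ℝ}
  (h : D.IsAdmissibleRun I Cstab Crel qred Cson Cmesh qalg lamAlgStar θ lamAlg lamPic Cmark)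

include h

/-- The closure estimate for a run that reaches level `m`. -/
theorem card_mesh_sub_le {m : ℕ} (hu : D.Used lamAlg lamPic I m 0 0) :
    ((I.mesh m).card : ℝ) - D.T₀.card ≤
      Cmesh * ∑ i ∈ Finset.range m, ((I.marked i).card : ℝ) := by
  -- The closure estimate concerns infinite sequences: beyond level `m`, nothing is marked.
  set M : ℕ → Finset E := fun i => if i < m then I.marked i else ∅ with hM
  set S : ℕ → Finset E := fun i => Nat.rec D.T₀ (fun i T => D.refine T (M i)) i with hS
  have hstep : ∀ i < m, I.marked i ⊆ I.mesh i ∧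
      I.mesh (i + 1) = D.refine (I.mesh i) (I.marked i) := fun i hi => by
    have := h.level_step (hu.of_level_le (i + 1) hi)
    exact ⟨this.1, this.2.1⟩
  have hSmesh : ∀ i ≤ m, S i = I.mesh i := fun i => by
    induction i with
    | zero => exact fun _ => h.run.mesh_zero.symm
    | succ i ih =>
      intro hi
      rw [(hstep i hi).2, ← ih (by omega)]
      change D.refine (S i) (M i) = _
      rw [hM]
      simp only [if_pos (show i < m from hi)]
  have hMS : ∀ i, M i ⊆ S i := fun i => by
    by_cases hi : i < m
    · rw [hSmesh i hi.le]
      simp only [hM, if_pos hi]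
      exact (hstep i hi).1
    · simp only [hM, if_neg hi]
      exact Finset.empty_subset _
  have := h.mesh.closure S M rfl hMS (fun _ => rfl) m
  rw [hSmesh m le_rfl] at this
  refine this.trans (le_of_eq ?_)
  congr 1
  refine Finset.sum_congr rfl fun i hi => ?_
  simp only [hM, if_pos (Finset.mem_range.1 hi)]

theorem card_marked_le {s A : ℝ} (hs : 0 < s) (hA : 0 ≤ A)
    (happrox : D.approxNorm s ≤ ENNReal.ofReal A) (hCmark : 1 ≤ Cmark)
    (ht : thetaPrime Cstab (qPic D.α D.L) qalg lamAlgStar θ lamAlg lamPic < thetaOpt Cstab Crel)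
    {ℓ : ℕ} (hu : D.Used lamAlg lamPic I (ℓ + 1) 0 0) :
    ((I.marked ℓ).card : ℝ) ≤ Cmark *
      ((A / (optFactor Cstab Crel (thetaPrime Cstab (qPic D.α D.L) qalg lamAlgStar θ lamAlg lamPic) /
        (1 + Cstab * Crel))) ^ s⁻¹ * (D.eta (I.mesh ℓ) (D.uStarOn (I.mesh ℓ)))⁻¹ ^ s⁻¹) := by
  have hT := (h.mem_X (hu.of_level_le ℓ (Nat.le_succ ℓ))).1
  obtain ⟨-, -, -, hpos, -, hmin, -⟩ := h.level_step hu
  have htp := thetaPrime_pos h.const h.param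
  have hκ := optFactor_mem h.const.stab_pos h.const.rel_pos htp ht
  obtain ⟨R, hR, hRd, hRc⟩ := h.exists_doerfler_card_le htp ht hs hA happrox hT hpos
  refine (hmin R hR hRd).trans (mul_le_mul_of_nonneg_left ?_ (by linarith))
  set κ := optFactor Cstab Crel (thetaPrime Cstab (qPic D.α D.L) qalg lamAlgStar θ lamAlg lamPic) /
    (1 + Cstab * Crel)
  have hκ0 : 0 < κ := div_pos hκ.1 (by nlinarith [mul_pos h.const.stab_pos h.const.rel_pos])
  rw [← Real.mul_rpow (by positivity) (by positivity),
    Real.le_rpow_inv_iff_of_pos (Nat.cast_nonneg _) (by positivity) hs, ← div_eq_mul_inv, div_div,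
    le_div_iff₀ (by positivity)]
  exact hRc

theorem weighted_le {s A : ℝ} (hs : 0 < s) (hA : 0 ≤ A)
    (happrox : D.approxNorm s ≤ ENNReal.ofReal A) (hCmark : 1 ≤ Cmark)
    (ht : thetaPrime Cstab (qPic D.α D.L) qalg lamAlgStar θ lamAlg lamPic < thetaOpt Cstab Crel)
    {m k j : ℕ} (hu : D.Used lamAlg lamPic I (m + 1) k j) :
    (((I.mesh (m + 1)).card : ℝ) - D.T₀.card + 1) ^ s * D.quasiError I (m + 1) k j ≤
      rateConst s D.α D.L Cstab Crel qred Cmark Cmesh θ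
        (finalConst (qPic D.α D.L) qalg lamAlg lamPic)
        (thetaPrime Cstab (qPic D.α D.L) qalg lamAlgStar θ lamAlg lamPic) * A := by
  have hu0 := hu.level
  have hα := h.const.alpha_pos
  have hL : 0 < D.L := hα.trans_le h.const.alpha_le
  have hCs := h.const.stab_pos
  have hCr := h.const.rel_pos
  have hK := finalConst_pos h.const h.param
  have hKθ := stab_mul_finalConst_lt h.const h.param
  have htp := thetaPrime_pos h.const h.param
  have hκ := (optFactor_mem hCs hCr htp ht).1
  have hϑ := exactTheta_mem h.const h.param
  have hmarked := fun i (hi : i < m + 1) =>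
    h.card_marked_le hs hA happrox hCmark ht (hu0.of_level_le (i + 1) hi)
  set K := finalConst (qPic D.α D.L) qalg lamAlg lamPic
  set t := thetaPrime Cstab (qPic D.α D.L) qalg lamAlgStar θ lamAlg lamPic
  set c := optFactor Cstab Crel t / (1 + Cstab * Crel) with hcdef
  have hc : 0 < c := by positivity
  set a : ℕ → ℝ := fun i => D.eta (I.mesh i) (D.uStarOn (I.mesh i)) with ha
  have hstep := fun i (hi : i ≤ m) => h.level_step (hu0.of_level_le (i + 1) (by omega))
  have hmesh := fun i (hi : i ≤ m) => (h.mem_X (hu0.of_level_le i (by omega))).1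
  have hrate := lyapRate_mem (Crel := Crel) hα hL hCs h.const.red_pos h.const.red_lt hϑ.1 hϑ.2
  have hratio := one_le_lyapRatio (Crel := Crel) hα hL hCs h.const.red_pos h.const.red_lt
    hϑ.1 hϑ.2
  have ha0 : ∀ i ≤ m, 0 < a i := fun i hi => (hstep i hi).2.2.2.1
  have hsum : ∑ i ∈ Finset.range (m + 1), (a i)⁻¹ ^ s⁻¹ ≤
      seriesConst s D.α D.L Cstab Crel qred (exactTheta Cstab K θ) * (a m)⁻¹ ^ s⁻¹ := by
    refine sum_inv_rpow_le (Q := fun i => D.lyap Cstab qred (exactTheta Cstab K θ) (I.mesh i))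
      hrate.1 hrate.2 (by linarith) hs ha0 (fun i hi => (h.lyap_bounds hϑ.1 hϑ.2 (hmesh i hi)).1)
      (fun i hi => (h.lyap_bounds hϑ.1 hϑ.2 (hmesh i hi)).2) fun i hi => ?_
    obtain ⟨hM, hT', -, -, hD, -⟩ := hstep i hi.le
    refine h.lyap_contract hϑ.1 hϑ.2 (hmesh i hi.le) ?_ hD
    rw [hT']
    exact refines_refine hM
  have hS0 : 0 ≤ seriesConst s D.α D.L Cstab Crel qred (exactTheta Cstab K θ) :=
    div_nonneg (Real.rpow_nonneg (by linarith) _)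
      (sub_nonneg.2 (Real.rpow_le_one hrate.1.le hrate.2.le (by positivity)))
  unfold rateConst
  rw [← hcdef]
  set C := seriesConst s D.α D.L Cstab Crel qred (exactTheta Cstab K θ)
  have hCm := h.const.mesh_pos
  have hcard : ((I.mesh (m + 1)).card : ℝ) - D.T₀.card + 1 ≤
      2 * Cmesh * Cmark * C * (A / c) ^ s⁻¹ * (a m)⁻¹ ^ s⁻¹ := by
    have h1 := h.card_mesh_sub_le hu0
    have h2 : (1 : ℝ) ≤ (I.mesh (m + 1)).card - D.T₀.card := by
      have := h.add_le_card_mesh hu0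
      have h3 : ((D.T₀.card + 1 : ℕ) : ℝ) ≤ (I.mesh (m + 1)).card := by
        exact_mod_cast (by omega : D.T₀.card + 1 ≤ (I.mesh (m + 1)).card)
      push_cast at h3
      linarith
    have h3 : ∑ i ∈ Finset.range (m + 1), ((I.marked i).card : ℝ) ≤
        Cmark * (A / c) ^ s⁻¹ * (C * (a m)⁻¹ ^ s⁻¹) := by
      refine (Finset.sum_le_sum fun i hi => hmarked i (Finset.mem_range.1 hi)).trans ?_
      simp only [← mul_assoc]
      rw [← Finset.mul_sum, mul_assoc _ C]
      exact mul_le_mul_of_nonneg_left hsum (by positivity)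
    have h4 := mul_le_mul_of_nonneg_left h3 hCm.le
    linarith
  have hpow : (((I.mesh (m + 1)).card : ℝ) - D.T₀.card + 1) ^ s ≤
      (2 * Cmesh * Cmark * C) ^ s * (A / c) * (a m)⁻¹ := by
    have h0 : (0 : ℝ) ≤ (I.mesh (m + 1)).card - D.T₀.card + 1 := by
      have : (D.T₀.card : ℝ) ≤ (I.mesh (m + 1)).card := by
        exact_mod_cast h.mesh.card_init_le (h.mem_X hu0).1
      linarith
    have ham := ha0 m le_rfl
    refine (Real.rpow_le_rpow h0 hcard hs.le).trans (le_of_eq ?_)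
    rw [Real.mul_rpow (by positivity) (by positivity), Real.mul_rpow (by positivity) (by positivity),
      Real.rpow_inv_rpow (by positivity) hs.ne', Real.rpow_inv_rpow (by positivity) hs.ne']
  have hq : D.quasiError I (m + 1) k j ≤
      levelConst (D.L / D.α) Cstab * transferConst Cstab Crel K * a m := by
    have hl : 0 ≤ levelConst (D.L / D.α) Cstab := by
      unfold levelConst
      positivity
    rw [mul_assoc]
    exact (h.quasiError_le_initial hu).trans
      (mul_le_mul_of_nonneg_left (hstep m le_rfl).2.2.2.2.2.2 hl)
  have ham := ha0 m le_rfl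
  calc _ ≤ (2 * Cmesh * Cmark * C) ^ s * (A / c) * (a m)⁻¹ *
        (levelConst (D.L / D.α) Cstab * transferConst Cstab Crel K * a m) :=
        mul_le_mul hpow hq (quasiError_nonneg _ _ _) (by positivity)
    _ = _ := by
        field_simp

theorem weightedError_le_approxNorm {s : ℝ} (hs : 0 < s) (hCmark : 1 ≤ Cmark)
    (ht : thetaPrime Cstab (qPic D.α D.L) qalg lamAlgStar θ lamAlg lamPic < thetaOpt Cstab Crel)
    {ℓ k j : ℕ} (hu : D.Used lamAlg lamPic I ℓ k j) (hℓ : 1 ≤ ℓ) :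
    D.weightedError I s ℓ k j ≤ ENNReal.ofReal (upperConst s D.α D.L Cstab Crel qred Cmark Cmesh
      qalg lamAlgStar θ lamAlg lamPic) * D.approxNorm s := by
  obtain ⟨m, rfl⟩ := Nat.exists_eq_add_of_le' hℓ
  have hC := upperConst_pos s D.α D.L Cstab Crel qred Cmark Cmesh qalg lamAlgStar θ lamAlg lamPic
  rcases eq_or_ne (D.approxNorm s) ⊤ with htop | htop
  · rw [htop, ENNReal.mul_top (ENNReal.ofReal_pos.2 hC).ne']
    exact le_top
  · rw [← ENNReal.ofReal_toReal htop, ← ENNReal.ofReal_mul hC.le]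
    refine ENNReal.ofReal_le_ofReal ((h.weighted_le hs ENNReal.toReal_nonneg
      (ENNReal.ofReal_toReal htop).ge hCmark ht hu).trans ?_)
    exact mul_le_mul_of_nonneg_right ((le_max_right _ _).trans (le_max_right _ _))
      ENNReal.toReal_nonneg

theorem weightedError_le_initial (s : ℝ) {Cm : ℝ} {k j : ℕ} (hu : D.Used lamAlg lamPic I 0 k j) :
    D.weightedError I s 0 k j ≤ ENNReal.ofReal (upperConst s D.α D.L Cstab Crel qred Cm Cmesh
      qalg lamAlgStar θ lamAlg lamPic) * ENNReal.ofReal (D.quasiError I 0 0 0) := by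
  rw [← ENNReal.ofReal_mul (upperConst_pos _ _ _ _ _ _ _ _ _ _ _ _ _).le, weightedError,
    h.run.mesh_zero, sub_self, zero_add, Real.one_rpow, one_mul]
  exact ENNReal.ofReal_le_ofReal ((h.quasiError_le_initial hu).trans
    (mul_le_mul_of_nonneg_right ((le_max_left _ _).trans (le_max_right _ _))
      (quasiError_nonneg _ _ _)))

end Setting.IsAdmissibleRun

end AFEM

theorem theorem3 :
    -- The arguments of the functions are the quantities the constants may depend on.
    -- `θStar Cstab Crel qPic qalg lamAlgStar`
    ∃ θStar : ℝ → ℝ → ℝ → ℝ → ℝ → ℝ,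
    -- `cOpt s (L/α) Cstab Crel Cson #T₀ ℓ̲`
    ∃ cOpt : ℝ → ℝ → ℝ → ℝ → ℝ → ℕ → ℕ∞ → ℝ,
    -- `COpt s α L Cstab Crel qred Cmark Cmesh #T₀ qalg lamAlgStar θ lamAlg lamPic`
    ∃ COpt : ℝ → ℝ → ℝ → ℝ → ℝ → ℝ → ℝ → ℝ → ℕ → ℝ → ℝ → ℝ → ℝ → ℝ → ℝ,
    (∀ a b c d e, 0 < θStar a b c d e) ∧
    (∀ s a b c d n l, 0 < cOpt s a b c d n l) ∧
    (∀ s a b c d e f g n h i j k l, 0 < COpt s a b c d e f g n h i j k l) ∧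
    ∀ (α L Cstab Crel qred Cson Cmesh qalg lamAlgStar : ℝ),
      AFEM.AdmissibleConstants α L Cstab Crel qred Cson Cmesh qalg lamAlgStar →
    ∀ (θ lamAlg lamPic : ℝ),
      AFEM.AdmissibleParameters lamAlgStar
        (AFEM.lamPicStar Cstab (AFEM.qPic α L) qalg lamAlgStar) θ lamAlg lamPic →
    -- For sufficiently small `θ` the marking condition `0 < θ' < θ_opt` holds.
    (θ < min 1 (θStar Cstab Crel (AFEM.qPic α L) qalg lamAlgStar) →
      0 < AFEM.thetaPrime Cstab (AFEM.qPic α L) qalg lamAlgStar θ lamAlg lamPic ∧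
      AFEM.thetaPrime Cstab (AFEM.qPic α L) qalg lamAlgStar θ lamAlg lamPic <
        AFEM.thetaOpt Cstab Crel) ∧
    -- Under the marking condition the algorithm has optimal rates.
    (AFEM.thetaPrime Cstab (AFEM.qPic α L) qalg lamAlgStar θ lamAlg lamPic <
        AFEM.thetaOpt Cstab Crel →
      ∀ (Cmark s : ℝ), 1 ≤ Cmark → 0 < s →
      ∀ (𝕜 : Type u) [RCLike 𝕜] (V : Type v) [NormedAddCommGroup V] [InnerProductSpace 𝕜 V]
        [CompleteSpace V] (E : Type w) [DecidableEq E] (D : AFEM.Setting 𝕜 V E),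
        D.α = α → D.L = L → D.IsOperator → D.IsRefinement Cson Cmesh → D.IsDiscretization →
        D.IsEstimator Cstab Crel qred → D.IsContractiveSolver qalg →
      ∀ I : AFEM.Iterates V E, D.IsRun lamAlg lamPic I θ Cmark →
        let c := cOpt s (L / α) Cstab Crel Cson D.T₀.card (D.lastMesh lamAlg lamPic I)
        let C := COpt s α L Cstab Crel qred Cmark Cmesh D.T₀.card qalg lamAlgStar θ lamAlg lamPic
        ENNReal.ofReal c⁻¹ * D.approxNorm s ≤
          (⨆ (ℓ : ℕ) (k : ℕ) (j : ℕ) (_ : D.Used lamAlg lamPic I ℓ k j),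
            D.weightedError I s ℓ k j) ∧
        (⨆ (ℓ : ℕ) (k : ℕ) (j : ℕ) (_ : D.Used lamAlg lamPic I ℓ k j),
            D.weightedError I s ℓ k j) ≤
          ENNReal.ofReal C * max (D.approxNorm s) (ENNReal.ofReal (D.quasiError I 0 0 0)) ∧
        (⨆ (ℓ : ℕ) (k : ℕ) (j : ℕ) (_ : D.Used lamAlg lamPic I ℓ k j ∧ 1 ≤ ℓ),
            D.weightedError I s ℓ k j) ≤
          ENNReal.ofReal C * D.approxNorm s) := by
  refine ⟨fun Cstab Crel _ _ _ => AFEM.thetaOpt Cstab Crel / (2 + AFEM.thetaOpt Cstab Crel),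
    fun s r Cstab _ Cson n _ => AFEM.lowerConst s r Cstab Cson n,
    fun s α L Cstab Crel qred Cmark Cmesh _ qalg lamAlgStar θ lamAlg lamPic =>
      AFEM.upperConst s α L Cstab Crel qred Cmark Cmesh qalg lamAlgStar θ lamAlg lamPic,
    fun a b _ _ _ => ?_, fun _ _ _ _ _ _ _ => AFEM.lowerConst_pos _ _ _ _ _,
    fun _ _ _ _ _ _ _ _ _ _ _ _ _ _ => AFEM.upperConst_pos _ _ _ _ _ _ _ _ _ _ _ _ _, ?_⟩
  · have := AFEM.thetaOpt_pos a b
    positivity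
  intro α L Cstab Crel qred Cson Cmesh qalg lamAlgStar hc θ lamAlg lamPic hp
  refine ⟨fun hθ => ⟨AFEM.thetaPrime_pos hc hp,
    AFEM.thetaPrime_lt_thetaOpt hc hp (hθ.trans_le (min_le_right _ _))⟩, ?_⟩
  intro ht Cmark s hCmark hs 𝕜 _ V _ _ _ E _ D hDα hDL hop hmesh hspace hest halg I hrun
  subst hDα hDL
  have h : D.IsAdmissibleRun I Cstab Crel qred Cson Cmesh qalg lamAlgStar θ lamAlg lamPic Cmark :=
    ⟨⟨hc, hop, hmesh, hspace, hest, halg⟩, hp, hrun⟩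
  refine ⟨?_, ?_, ?_⟩
  · have hpos := AFEM.lowerConst_pos s (D.L / D.α) Cstab Cson D.T₀.card
    rw [ENNReal.ofReal_inv_of_pos hpos, mul_comm, ← div_eq_mul_inv]
    refine ENNReal.div_le_of_le_mul ?_
    rw [mul_comm]
    exact h.approxNorm_le hs
  · refine iSup_le fun ℓ => iSup_le fun k => iSup₂_le fun j hu => ?_
    rcases Nat.eq_zero_or_pos ℓ with rfl | hℓ
    · exact (h.weightedError_le_initial s hu).trans (mul_le_mul_right (le_max_right _ _) _)
    · exact (h.weightedError_le_approxNorm hs hCmark ht hu hℓ).trans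
        (mul_le_mul_right (le_max_left _ _) _)
  · exact iSup_le fun ℓ => iSup_le fun k => iSup₂_le fun j hu =>
      h.weightedError_le_approxNorm hs hCmark ht hu.1 hu.2
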